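/- A finite polysquare translation surface $\mathcal{P}$ is a connected surface obtained from finitely many, say $s\ge1$, closed unit squares (the atomic squares) by identifying, by translations, every right edge with exactly one left edge and every top edge with exactly one bottom edge. A point of $\mathcal{P}$ is singular if the total angle at it exceeds $2\pi$. Let $\mathcal{M}=\mathcal{P}\times[0,1)$ denote the associated polycube translation $3$-manifold, that is, the cartesian product of $\mathcal{P}$ and the unit torus $[0,1)=\mathbb{R}/\mathbb{Z}$, tiled by the $s$ atomic cubes which are the products of the atomic squares with $[0,1)$; its singular points are the points over the singular points of $\mathcal{P}$. A vector in $\mathbb{R}^n$ is called a Kronecker direction if its coordinates are linearly independent over $\mathbb{Q}$. A half-infinite geodesic $\mathcal{L}(t)$, $t\ge0$, with a given direction is a curve that moves along straight segments with the given vector as its velocity, passing through the identified edges or faces, and that never meets a singular point. It is uniformly distributed if, for every convex set $S$ in an atomic square (respectively, atomic cube), $$\lim_{T\to\infty}\frac{1}{T}\,\lambda_1(\{t\in[0,T]:\mathcal{L}(t)\in S\})=\frac{\lambda(S)}{s},$$ where $\lambda_1$ is Lebesgue measure on $\mathbb{R}$ and $\lambda(S)$ is the area (respectively, volume) of $S$.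 Theorem 6. Suppose that $\mathcal{P}$ is a finite polysquare translation surface, that $\mathcal{M}=\mathcal{P}\times[0,1)$ is the associated polycube translation $3$-manifold, and that $\mathbf{v}\in\mathbb{R}^2$ is a Kronecker direction. Then the following two statements are equivalent: (i) Every half-infinite geodesic with direction $\mathbf{v}$ on $\mathcal{P}$ is uniformly distributed. (ii) For every $w\in\mathbb{R}$ such that $\mathbf{w}=(\mathbf{v},w)\in\mathbb{R}^3$ is a Kronecker direction, every half-infinite geodesic with direction $\mathbf{w}$ in $\mathcal{M}$ is uniformly distributed. -/

import Mathlib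

open Set Filter Topology MeasureTheory

noncomputable section

/-- A vector of `ℝⁿ` is a Kronecker direction if its coordinates are linearly independent over
`ℚ`. For a vector `(v₁, …, v_d, 1)` this says that `v₁, …, v_d, 1` are linearly independent. -/
def IsKroneckerDirection {n : ℕ} (v : Fin n → ℝ) : Prop :=
  LinearIndependent ℚ v

/-- The closed unit cube `[0,1]ⁿ`. -/
abbrev UnitCell (n : ℕ) : Set (Fin n → ℝ) := Set.Icc 0 1

section Cells

variable {n : ℕ} {ι X : Type*}

/-- Let the space `X` be tiled by unit `n`-cubes, indexed by `ι`, through the maps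
`chart i : [0,1]ⁿ → X`, and let `sing ⊆ X` be its set of singular points. A half-infinite
geodesic `L t`, `t ≥ 0`, with direction `v` is a curve that never meets a singular point and that,
immediately after every time `t ≥ 0` and immediately before every time `t > 0`, runs inside one
of the cubes along a straight segment with velocity `v`. The values of `L` at negative times
play no role. -/
structure IsHalfInfiniteGeodesic (chart : ι → UnitCell n → X) (sing : Set X)
    (v : Fin n → ℝ) (L : ℝ → X) : Prop where
  notMem_sing : ∀ t : ℝ, 0 ≤ t → L t ∉ sing
  forward : ∀ t : ℝ, 0 ≤ t → ∃ (i : ι) (p : Fin n → ℝ) (ε : ℝ), 0 < ε ∧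
    ∀ h ∈ Set.Icc (0 : ℝ) ε, ∃ hp : p + h • v ∈ UnitCell n, L (t + h) = chart i ⟨p + h • v, hp⟩
  backward : ∀ t : ℝ, 0 < t → ∃ (i : ι) (p : Fin n → ℝ) (ε : ℝ), 0 < ε ∧
    ∀ h ∈ Set.Icc (0 : ℝ) ε, ∃ hp : p - h • v ∈ UnitCell n, L (t - h) = chart i ⟨p - h • v, hp⟩

/-- A curve `L t`, `t ≥ 0`, in a space tiled by finitely many unit cubes is uniformly distributed
if, for every convex set `S` in one of the cubes, the proportion of the time interval `[0,T]` that
it spends in `S` tends, as `T → ∞`, to the Lebesgue measure of `S` divided by the number of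
cubes. -/
def IsUniformlyDistributed [Fintype ι] (chart : ι → UnitCell n → X) (L : ℝ → X) : Prop :=
  ∀ (i : ι) (S : Set (Fin n → ℝ)), S ⊆ UnitCell n → Convex ℝ S →
    Tendsto
      (fun T : ℝ => volume.real {t : ℝ | t ∈ Set.Icc 0 T ∧ L t ∈ chart i '' (Subtype.val ⁻¹' S)} / T)
      atTop (𝓝 (volume.real S / (Fintype.card ι : ℝ)))

end Cells

/-- The combinatorial data of a polysquare translation surface whose atomic squares are
indexed by `ι`: the right edge of the square `i` is identified by translation with the left edge
of the square `right i`, the top edge of `i` with the bottom edge of `up i`, and any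
two squares are joined by a chain of squares in which neighbours share an edge. The surface is
finite if `ι` is. -/
structure PolysquareSurface (ι : Type*) where
  right : Equiv.Perm ι
  up : Equiv.Perm ι
  nonempty : Nonempty ι
  connected : ∀ i j : ι, Relation.EqvGen (fun a b => b = right a ∨ b = up a) i j

namespace PolysquareSurface

variable {ι : Type*}

/-- The edge identifications between the closed unit squares `{i} × [0,1]²`. -/
inductive Glue (P : PolysquareSurface ι) : ι × UnitCell 2 → ι × UnitCell 2 → Prop
  | right (i : ι) (p q : UnitCell 2) (hp : p.1 0 = 1) (hq : q.1 0 = 0) (h : p.1 1 = q.1 1) :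
      Glue P (i, p) (P.right i, q)
  | up (i : ι) (p q : UnitCell 2) (hp : p.1 1 = 1) (hq : q.1 1 = 0) (h : p.1 0 = q.1 0) :
      Glue P (i, p) (P.up i, q)

/-- The points of the surface: the disjoint union of the closed unit squares, modulo the
equivalence relation generated by the edge identifications. -/
def Point (P : PolysquareSurface ι) : Type _ := Quot P.Glue

/-- The inclusion of the atomic square `i` in the surface. -/
def square (P : PolysquareSurface ι) (i : ι) (p : UnitCell 2) : P.Point :=
  Quot.mk P.Glue (i, p)

/-- The singular points of the surface: the points in which more than four corners of atomic
squares meet, that is, where the total angle exceeds `2π`. -/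
def singularSet (P : PolysquareSurface ι) : Set P.Point :=
  {x | 4 < {c : ι × UnitCell 2 | (∀ k, c.2.1 k = 0 ∨ c.2.1 k = 1) ∧
    P.square c.1 c.2 = x}.encard}

/-- The associated polycube translation 3-manifold: the cartesian product of the surface and the
unit torus `ℝ/ℤ`. -/
def Manifold (P : PolysquareSurface ι) : Type _ := P.Point × UnitAddCircle

/-- The projection of the unit cube to the unit square that drops the third coordinate. -/
def dropLast (q : UnitCell 3) : UnitCell 2 :=
  ⟨Fin.init q.1, fun k => q.2.1 k.castSucc, fun k => q.2.2 k.castSucc⟩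

/-- The inclusion of the atomic cube `i`, the product of the atomic square `i` with `ℝ/ℤ`, in the
associated 3-manifold. -/
def cube (P : PolysquareSurface ι) (i : ι) (q : UnitCell 3) : P.Manifold :=
  (P.square i (dropLast q), ((q.1 2 : ℝ) : UnitAddCircle))

/-- The singular points of the associated 3-manifold: the points over a singular point of the
surface. -/
def manifoldSingularSet (P : PolysquareSurface ι) : Set P.Manifold :=
  {x | x.1 ∈ P.singularSet}

end PolysquareSurface

end

/-! (i) implies (ii). A geodesic with direction (v, w) projects to a geodesic on the surface, which
is uniformly distributed by (i). Recording the position modulo 1 together with the atomic square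
turns both curves into curves on `ι` copies ("sheets") of a torus, of dimension 2 or 3. The
occupation measures up to time T live on a compact space, so it suffices to show that each of their
limits ν is uniform.

The projection of ν to the sheets of the 2-torus is already uniform. Disintegrate ν over it and let
c(i, x) be the k-th Fourier coefficient, k ≠ 0, of the conditional measure on the circle over x in
sheet i. The third coordinate moves with speed w whatever the square, so invariance of ν in time
gives c(σ i, x + τv) = exp(2πikwτ) c(i, x), where σ is the permutation of the sheets caused by
crossing an edge, or the identity (`exists_perm_sheet`, `ae_fiberCoeff_shift`). The power sums ∑ᵢ
c(i, x)^j do not see σ, hence are eigenfunctions of the linear flow on the 2-torus with frequency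
jkw.

The relation is used only where the displacement τv does not cross edges of both kinds. The
remaining x, near a corner, where the order of the crossings matters, form a set of measure O(τ²)
and are discarded. If a is the Fourier coefficient of the power sum at m, then |a| |exp(iγτ) - 1| =
O(τ²) with γ = 2π(jkw + m·v), and γ ≠ 0 because (v, w) is a Kronecker direction. Dividing by τ → 0
gives a = 0 (`ae_eq_zero_of_eigenfunction`). So all power sums of positive order vanish almost
everywhere, and with them c (`eq_zero_of_sum_pow_eq_zero`). The conditional measures are then Haar
and ν is uniform (`limit_eq_uniform`). Boundaries of convex sets are null, so weak convergence
yields the required proportions.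

(ii) implies (i). The rational span of v is countable, so some w makes (v, w) a Kronecker direction.
A geodesic on the surface lifts to direction (v, w), and testing the lift on the cylinder over S
gives the claim for S. -/

/-! ### Power sums and uniqueness of Fourier coefficients -/

/-- Only the zero family has vanishing power sums of all positive orders. -/
theorem eq_zero_of_sum_pow_eq_zero {ι : Type*} [Fintype ι] (a : ι → ℂ)
    (h : ∀ j : ℕ, 0 < j → ∑ i, a i ^ j = 0) : ∀ i, a i = 0 := by
  classical
  have key : ∀ p : Polynomial ℂ, p.coeff 0 = 0 → ∑ i, p.eval (a i) = 0 := by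
    intro p hp
    simp_rw [Polynomial.eval_eq_sum_range]
    rw [Finset.sum_comm]
    refine Finset.sum_eq_zero fun j _ => ?_
    rw [← Finset.mul_sum]
    rcases Nat.eq_zero_or_pos j with rfl | hj
    · simp [hp]
    · rw [h j hj, mul_zero]
  by_contra! hne
  obtain ⟨i₀, hi₀⟩ := hne
  -- The node 0 forces the interpolation polynomial to have no constant term, so that `key` applies
  -- to it.
  let s : Finset ℂ := insert 0 (Finset.univ.image a)
  let p := Lagrange.interpolate s id (fun z => if z = a i₀ then (1 : ℂ) else 0)
  have ev : ∀ z ∈ s, p.eval z = if z = a i₀ then (1 : ℂ) else 0 := fun z hz =>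
    Lagrange.eval_interpolate_at_node _ (injOn_id _) hz
  have h0 : p.coeff 0 = 0 := by
    rw [Polynomial.coeff_zero_eq_eval_zero, ev 0 (by simp [s])]
    simp [hi₀.symm]
  have hsum := key p h0
  have : ∀ i, p.eval (a i) = if a i = a i₀ then (1 : ℂ) else 0 := fun i => ev _ (by simp [s])
  simp_rw [this] at hsum
  -- The sum counts the indices with `a i = a i₀`; in characteristic zero its vanishing means that
  -- there are none.
  rw [Finset.sum_boole] at hsum
  have : (Finset.univ.filter fun i => a i = a i₀).card = 0 := by exact_mod_cast hsum
  rw [Finset.card_eq_zero] at this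
  exact Finset.notMem_empty i₀ (this ▸ by simp)


/-- A probability measure on the circle whose nonzero Fourier coefficients vanish is the Haar
measure. -/
theorem eq_volume_of_integral_fourier_eq_zero (μ : Measure UnitAddCircle) [IsProbabilityMeasure μ]
    (h : ∀ k : ℤ, k ≠ 0 → ∫ z, fourier k z ∂μ = 0) : μ = volume := by
  have hv : ∀ k : ℤ, k ≠ 0 → ∫ z : UnitAddCircle, fourier k z = 0 := by
    intro k hk
    -- The mean of a character is its own Fourier coefficient at 0.
    have h2 := congrFun (fourierCoeff_fourier (T := 1) k) 0
    rw [fourierCoeff, Pi.single_eq_of_ne hk.symm] at h2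
    rw [← h2, AddCircle.volume_eq_smul_haarAddCircle]
    simp
  have hp : IsProbabilityMeasure (volume : Measure UnitAddCircle) := ⟨by simp⟩
  have hint : ∀ (ν : Measure UnitAddCircle) [IsProbabilityMeasure ν] (g : C(UnitAddCircle, ℂ)),
      Integrable g ν := fun ν _ g =>
    Integrable.of_bound g.continuous.aestronglyMeasurable ‖g‖
      (Eventually.of_forall fun x => g.norm_coe_le_norm x)
  have hcont : ∀ (ν : Measure UnitAddCircle) [IsProbabilityMeasure ν],
      Continuous fun g : C(UnitAddCircle, ℂ) => ∫ z, g z ∂ν := by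
    intro ν _
    refine (LipschitzWith.of_dist_le_mul (K := 1) fun f g => ?_).continuous
    rw [dist_eq_norm, ← integral_sub (hint ν f) (hint ν g), dist_eq_norm, NNReal.coe_one, one_mul]
    refine (norm_integral_le_of_norm_le_const (C := ‖f - g‖)
      (Eventually.of_forall fun x => (f - g).norm_coe_le_norm x)).trans (by simp)
  have hclosed : IsClosed {g : C(UnitAddCircle, ℂ) | ∫ z, g z ∂μ = ∫ z, g z} :=
    isClosed_eq (hcont μ) (hcont volume)
  have hspan : (Submodule.span ℂ (range (@fourier 1)) : Set C(UnitAddCircle, ℂ)) ⊆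
      {g : C(UnitAddCircle, ℂ) | ∫ z, g z ∂μ = ∫ z, g z} := by
    intro g hg
    induction hg using Submodule.span_induction with
    | mem g hg =>
      obtain ⟨k, rfl⟩ := hg
      rcases eq_or_ne k 0 with rfl | hk
      · simp
      · exact (h k hk).trans (hv k hk).symm
    | zero => simp
    | add f g _ _ hf hg =>
      simp only [mem_ofPred_eq, ContinuousMap.add_apply] at *
      rw [integral_add (hint μ f) (hint μ g), integral_add (hint _ f) (hint _ g), hf, hg]
    | smul c f _ hf =>
      simp only [mem_ofPred_eq, ContinuousMap.smul_apply] at *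
      rw [integral_smul, integral_smul, hf]
  have hall : ∀ g : C(UnitAddCircle, ℂ), ∫ z, g z ∂μ = ∫ z, g z := by
    intro g
    have hg : g ∈ (Submodule.span ℂ (range (@fourier 1))).topologicalClosure := by
      rw [span_fourier_closure_eq_top]; trivial
    exact closure_minimal hspan hclosed hg
  refine ext_of_forall_integral_eq_of_IsFiniteMeasure fun f => ?_
  have := hall ⟨fun z => (f z : ℂ), by fun_prop⟩
  simp only [ContinuousMap.coe_mk] at this
  rw [integral_complex_ofReal, integral_complex_ofReal] at this
  exact_mod_cast this

/-- A bounded function on the torus whose Fourier coefficients all vanish is zero almost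
everywhere. -/
theorem ae_eq_zero_of_integral_mFourier_mul_eq_zero {d : Type*} [Fintype d]
    (D : UnitAddTorus d → ℂ) (hD : AEStronglyMeasurable D volume) (C : ℝ) (hC : ∀ x, ‖D x‖ ≤ C)
    (h : ∀ n : d → ℤ, ∫ x, UnitAddTorus.mFourier n x * D x = 0) : D =ᵐ[volume] 0 := by
  have hint : ∀ g : C(UnitAddTorus d, ℂ), Integrable (fun x => g x * D x) volume := fun g =>
    Integrable.of_bound (g.continuous.aestronglyMeasurable.mul hD) (‖g‖ * C)
      (Eventually.of_forall fun x => by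
        rw [norm_mul]
        exact mul_le_mul (g.norm_coe_le_norm x) (hC x) (norm_nonneg _) (norm_nonneg _))
  have hcont : Continuous fun g : C(UnitAddTorus d, ℂ) => ∫ x, g x * D x := by
    refine (LipschitzWith.of_dist_le_mul (K := C.toNNReal) fun f g => ?_).continuous
    rw [dist_eq_norm, ← integral_sub (hint f) (hint g), dist_eq_norm, mul_comm]
    have hC0 : 0 ≤ C := (norm_nonneg _).trans (hC 0)
    refine (norm_integral_le_of_norm_le_const (C := ‖f - g‖ * C)
      (Eventually.of_forall fun x => ?_)).trans ?_
    · rw [← sub_mul, norm_mul]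
      exact mul_le_mul ((f - g).norm_coe_le_norm x) (hC x) (norm_nonneg _) (norm_nonneg _)
    · simp [measureReal_def, volume_pi, Measure.pi_univ, hC0]
  have hspan : (Submodule.span ℂ (range (UnitAddTorus.mFourier (d := d))) :
      Set C(UnitAddTorus d, ℂ)) ⊆ {g : C(UnitAddTorus d, ℂ) | ∫ x, g x * D x = 0} := by
    intro g hg
    induction hg using Submodule.span_induction with
    | mem g hg =>
      obtain ⟨k, rfl⟩ := hg
      exact h k
    | zero => simp
    | add f g _ _ hf hg =>
      simp only [mem_ofPred_eq, ContinuousMap.add_apply, add_mul] at *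
      rw [integral_add (hint f) (hint g), hf, hg, add_zero]
    | smul c f _ hf =>
      simp only [mem_ofPred_eq, ContinuousMap.smul_apply, smul_mul_assoc] at *
      rw [integral_smul, hf, smul_zero]
  have hall : ∀ g : C(UnitAddTorus d, ℂ), ∫ x, g x * D x = 0 := by
    intro g
    have hg : g ∈ (Submodule.span ℂ (range (UnitAddTorus.mFourier (d := d)))).topologicalClosure := by
      rw [UnitAddTorus.span_mFourier_closure_eq_top]; trivial
    exact closure_minimal hspan (isClosed_eq hcont continuous_const) hg
  have hL : MemLp D 2 volume := MemLp.of_bound hD C (Eventually.of_forall hC)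
  have hdense := ContinuousMap.toLp_denseRange ℂ (volume : Measure (UnitAddTorus d)) ℂ
    (p := 2) (by simp)
  have hzero : hL.toLp D = 0 := by
    -- `D` is orthogonal in L² to the dense set of continuous functions; the inner product
    -- conjugates, whence `star g`.
    refine hdense.eq_zero_of_inner_left (𝕜 := ℂ) fun g => ?_
    rw [← inner_conj_symm, L2.inner_def, ← map_zero (starRingEnd ℂ)]
    congr 1
    rw [← hall (star g)]
    refine integral_congr_ae ?_
    filter_upwards [hL.coeFn_toLp, ContinuousMap.coeFn_toLp (p := 2) volume (𝕜 := ℂ) g]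
      with x h1 h2
    rw [h1, h2]
    simp [mul_comm]
  exact (MemLp.toLp_eq_toLp_iff hL (MemLp.zero)).1 (by rw [hzero]; rfl)

/-! ### Approximate eigenfunctions of linear flows on the torus -/

/-- The projection of `ℝⁿ` to the torus. -/
def torusMk {n : ℕ} (y : Fin n → ℝ) : Fin n → UnitAddCircle := fun d => (y d : UnitAddCircle)

theorem torusMk_add {n : ℕ} (x y : Fin n → ℝ) : torusMk (x + y) = torusMk x + torusMk y := rfl

theorem torusMk_sub {n : ℕ} (x y : Fin n → ℝ) : torusMk (x - y) = torusMk x - torusMk y := rfl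

theorem continuous_torusMk {n : ℕ} : Continuous (torusMk (n := n)) :=
  continuous_pi fun d => (AddCircle.continuous_mk' 1).comp (continuous_apply d)

theorem isOpenMap_torusMk {n : ℕ} : IsOpenMap (torusMk (n := n)) :=
  IsOpenMap.piMap (fun _ => QuotientAddGroup.isOpenMap_coe)
    (Eventually.of_forall fun _ => QuotientAddGroup.mk_surjective)

theorem mFourier_add_torusMk {n : ℕ} (m : Fin n → ℤ) (x : Fin n → UnitAddCircle) (y : Fin n → ℝ) :
    UnitAddTorus.mFourier m (x + torusMk y) = UnitAddTorus.mFourier m x *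
      Complex.exp (((2 * Real.pi * ∑ d, m d * y d : ℝ) : ℂ) * Complex.I) := by
  have h1 : ∀ (k : ℤ) (a b : UnitAddCircle),
      fourier k (a + b) = fourier k a * fourier k b := by
    intro k a b
    simp [smul_add, AddCircle.toCircle_add]
  simp only [UnitAddTorus.mFourier, ContinuousMap.coe_mk, Pi.add_apply, h1, Finset.prod_mul_distrib]
  congr 1
  simp only [torusMk, fourier_coe_apply]
  rw [← Complex.exp_sum]
  congr 1
  push_cast
  rw [Finset.mul_sum, Finset.sum_mul]
  exact Finset.sum_congr rfl fun d _ => by ring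

/-- A number `a` with `‖a (1 - exp (i γ τ))‖ = O(τ²)` as `τ → 0+` vanishes if `γ ≠ 0`. -/
theorem eq_zero_of_norm_mul_exp_le {a γ A δ : ℝ} (hγ : γ ≠ 0) (hδ : 0 < δ)
    (h : ∀ τ ∈ Ioo 0 δ, a * ‖Complex.exp (((γ * τ : ℝ) : ℂ) * Complex.I) - 1‖ ≤ A * τ ^ 2) :
    a ≤ 0 := by
  have hd : HasDerivAt (fun τ : ℝ => Complex.exp (((γ * τ : ℝ) : ℂ) * Complex.I))
      (γ * Complex.I) 0 := by
    have h1 : HasDerivAt (fun τ : ℝ => ((γ * τ : ℝ) : ℂ) * Complex.I) (γ * Complex.I) 0 := by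
      have := ((hasDerivAt_id (0 : ℝ)).const_mul γ).ofReal_comp.mul_const Complex.I
      simpa using this
    simpa using h1.cexp
  -- After division by τ the left side is a difference quotient with limit `a * |γ|`, while the
  -- bound becomes `A * τ`, which tends to 0.
  have hlim : Tendsto (fun τ : ℝ =>
      a * ‖τ⁻¹ • (Complex.exp (((γ * τ : ℝ) : ℂ) * Complex.I) - 1)‖) (𝓝[>] 0) (𝓝 (a * |γ|)) := by
    have := (hd.tendsto_slope_zero_right.norm).const_mul a
    simpa using this
  have hlim2 : Tendsto (fun τ : ℝ => A * τ) (𝓝[>] 0) (𝓝 0) := by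
    have : Tendsto (fun τ : ℝ => A * τ) (𝓝 0) (𝓝 (A * 0)) := tendsto_id.const_mul A
    rw [mul_zero] at this
    exact this.mono_left nhdsWithin_le_nhds
  have hle : a * |γ| ≤ 0 := by
    refine le_of_tendsto_of_tendsto hlim hlim2 ?_
    filter_upwards [Ioo_mem_nhdsGT hδ] with τ hτ
    have := h τ hτ
    rw [norm_smul, norm_inv, Real.norm_eq_abs, abs_of_pos hτ.1]
    have hτ0 : 0 < τ := hτ.1
    calc a * (τ⁻¹ * ‖Complex.exp (((γ * τ : ℝ) : ℂ) * Complex.I) - 1‖)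
        = τ⁻¹ * (a * ‖Complex.exp (((γ * τ : ℝ) : ℂ) * Complex.I) - 1‖) := by ring
      _ ≤ τ⁻¹ * (A * τ ^ 2) := by gcongr
      _ = A * τ := by field_simp
  have : 0 < |γ| := abs_pos.2 hγ
  by_contra! ha
  nlinarith

instance isProbabilityMeasure_torus {n : ℕ} :
    IsProbabilityMeasure (volume : Measure (Fin n → UnitAddCircle)) :=
  ⟨by simp [volume_pi, Measure.pi_univ]⟩

/-- A bounded function on the torus that is an eigenfunction of a linear flow, up to sets of
measure `O(τ²)` for the flow at time `τ → 0+`, with an eigenvalue that is not one of the flow,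
is zero almost everywhere. -/
theorem ae_eq_zero_of_eigenfunction {n : ℕ} (F : (Fin n → UnitAddCircle) → ℂ)
    (hF : AEStronglyMeasurable F volume) {C : ℝ} (hC : ∀ x, ‖F x‖ ≤ C) (v : Fin n → ℝ) (θ : ℝ)
    (hθ : ∀ m : Fin n → ℤ, θ ≠ 2 * Real.pi * ∑ d, m d * v d)
    {δ A : ℝ} (hδ : 0 < δ) (R : ℝ → Set (Fin n → UnitAddCircle))
    (hRm : ∀ τ, MeasurableSet (R τ))
    (hR : ∀ τ ∈ Ioo 0 δ, volume.real (R τ) ≤ A * τ ^ 2)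
    (hflow : ∀ τ ∈ Ioo 0 δ, ∀ᵐ x, x ∉ R τ →
      F (x + torusMk (τ • v)) = Complex.exp (((θ * τ : ℝ) : ℂ) * Complex.I) * F x) :
    F =ᵐ[volume] 0 := by
  refine ae_eq_zero_of_integral_mFourier_mul_eq_zero F hF C hC fun m => ?_
  set a : ℂ := ∫ x, UnitAddTorus.mFourier m x * F x with ha
  set β : ℝ := 2 * Real.pi * ∑ d, m d * v d with hβ
  have hC0 : 0 ≤ C := (norm_nonneg _).trans (hC 0)
  have hm : ∀ x, ‖UnitAddTorus.mFourier m x‖ ≤ 1 := fun x =>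
    ((UnitAddTorus.mFourier m).norm_coe_le_norm x).trans UnitAddTorus.mFourier_norm.le
  have hγ : θ + β ≠ 0 := by
    intro h0
    -- Integrating against the character `m` picks out the component along the character `-m`, so
    -- the resonance to be excluded is `θ = -β`.
    apply hθ (-m)
    have : θ = -β := by linarith
    rw [this, hβ]
    simp [Finset.sum_neg_distrib]
  have hexp : ∀ r : ℝ, ‖Complex.exp ((r : ℂ) * Complex.I)‖ = 1 := Complex.norm_exp_ofReal_mul_I
  have hest : ∀ τ ∈ Ioo 0 δ,
      ‖a‖ * ‖Complex.exp ((((θ + β) * τ : ℝ) : ℂ) * Complex.I) - 1‖ ≤ (2 * C * A) * τ ^ 2 := by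
    intro τ hτ
    set c := Complex.exp (((θ * τ : ℝ) : ℂ) * Complex.I) with hc
    set b := Complex.exp (((β * τ : ℝ) : ℂ) * Complex.I) with hb
    have hint : ∀ G : (Fin n → UnitAddCircle) → ℂ, AEStronglyMeasurable G volume →
        (∀ x, ‖G x‖ ≤ C) → Integrable (fun x => UnitAddTorus.mFourier m x * G x) volume :=
      fun G hG hGC => Integrable.of_bound
        ((UnitAddTorus.mFourier m).continuous.aestronglyMeasurable.mul hG) C
        (Eventually.of_forall fun x => by
          rw [norm_mul]
          calc _ ≤ 1 * C := mul_le_mul (hm x) (hGC x) (norm_nonneg _) zero_le_one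
            _ = C := one_mul C)
    have hshift : AEStronglyMeasurable (fun x => F (x + torusMk (τ • v))) volume :=
      hF.comp_measurePreserving (measurePreserving_add_right volume (torusMk (τ • v)))
    have h1 : ∫ x, UnitAddTorus.mFourier m x * F (x + torusMk (τ • v)) = b⁻¹ * a := by
      have h2 : a = ∫ x, UnitAddTorus.mFourier m (x + torusMk (τ • v)) *
          F (x + torusMk (τ • v)) :=
        (integral_add_right_eq_self (fun x => UnitAddTorus.mFourier m x * F x) _).symm
      have h3 : ∀ x, UnitAddTorus.mFourier m (x + torusMk (τ • v)) * F (x + torusMk (τ • v)) =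
          b * (UnitAddTorus.mFourier m x * F (x + torusMk (τ • v))) := by
        intro x
        rw [mFourier_add_torusMk]
        have : 2 * Real.pi * ∑ d, (m d : ℝ) * (τ • v) d = β * τ := by
          rw [hβ, mul_assoc (2 * Real.pi) _ τ, Finset.sum_mul]
          simp only [Pi.smul_apply, smul_eq_mul]
          congr 1
          exact Finset.sum_congr rfl fun d _ => by ring
        rw [this, ← hb]
        ring
      simp_rw [h3] at h2
      rw [integral_const_mul] at h2
      rw [h2, inv_mul_cancel_left₀ (Complex.exp_ne_zero _)]
    -- Off `R τ` the integrand vanishes by the eigenfunction relation; on `R τ` it is at most `2 *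
    -- C`.
    have h4 : ‖∫ x, (UnitAddTorus.mFourier m x * F (x + torusMk (τ • v)) -
        c * (UnitAddTorus.mFourier m x * F x))‖ ≤ ∫ x, (R τ).indicator (fun _ => 2 * C) x := by
      refine norm_integral_le_of_norm_le
        ((integrable_const _).indicator (hRm τ)) ?_
      filter_upwards [hflow τ hτ] with x hx
      by_cases hxR : x ∈ R τ
      · rw [indicator_of_mem hxR]
        have e : UnitAddTorus.mFourier m x * F (x + torusMk (τ • v)) -
            c * (UnitAddTorus.mFourier m x * F x) =
            UnitAddTorus.mFourier m x * (F (x + torusMk (τ • v)) - c * F x) := by ring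
        rw [e, norm_mul]
        have : ‖F (x + torusMk (τ • v)) - c * F x‖ ≤ 2 * C := by
          refine (norm_sub_le _ _).trans ?_
          rw [norm_mul, hc, hexp, one_mul]
          linarith [hC (x + torusMk (τ • v)), hC x]
        calc _ ≤ 1 * (2 * C) := mul_le_mul (hm x) this (norm_nonneg _) zero_le_one
          _ = 2 * C := one_mul _
      · rw [indicator_of_notMem hxR, hx hxR]
        apply le_of_eq
        rw [norm_eq_zero]
        ring
    rw [integral_sub (hint _ hshift fun x => hC _) ((hint _ hF hC).const_mul c),
      integral_const_mul, h1, ← ha, integral_indicator (hRm τ), setIntegral_const] at h4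
    have h5 : ‖b⁻¹ * a - c * a‖ =
        ‖a‖ * ‖Complex.exp ((((θ + β) * τ : ℝ) : ℂ) * Complex.I) - 1‖ := by
      have : Complex.exp ((((θ + β) * τ : ℝ) : ℂ) * Complex.I) = c * b := by
        rw [hc, hb, ← Complex.exp_add]
        congr 1
        push_cast
        ring
      rw [this]
      have hb0 : b ≠ 0 := Complex.exp_ne_zero _
      have e : b⁻¹ * a - c * a = -(b⁻¹ * (a * (c * b - 1))) := by field_simp; ring
      rw [e, norm_neg, norm_mul, norm_inv, hb, hexp, inv_one, one_mul, norm_mul]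
    rw [← h5]
    refine h4.trans ?_
    rw [smul_eq_mul]
    nlinarith [hR τ hτ]
  exact norm_le_zero_iff.1 (eq_zero_of_norm_mul_exp_le hγ hδ hest)

/-! ### Occupation measures and their limits -/

/-- The uniform distribution on `[0, max T 1]`. -/
noncomputable def timeUniform (T : ℝ) : ProbabilityMeasure ℝ :=
  ⟨(ENNReal.ofReal (max T 1))⁻¹ • volume.restrict (Icc 0 (max T 1)), ⟨by
    have h : 0 < max T 1 := lt_max_of_lt_right one_pos
    simp only [Measure.smul_apply, Measure.restrict_apply_univ, Real.volume_Icc, sub_zero,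
      smul_eq_mul]
    exact ENNReal.inv_mul_cancel (by simp) (by simp)⟩⟩

section Occupation

variable {K : Type*} [MeasurableSpace K]

/-- The occupation measure of a curve: the distribution of `Φ t` for a uniformly distributed random
time `t` in `[0, max T 1]`. -/
noncomputable def occupation (Φ : ℝ → K) (hΦ : Measurable Φ) (T : ℝ) : ProbabilityMeasure K :=
  (timeUniform T).map hΦ.aemeasurable

theorem occupation_apply (Φ : ℝ → K) (hΦ : Measurable Φ) {T : ℝ} (hT : 1 ≤ T) {A : Set K}
    (hA : MeasurableSet A) :
    (occupation Φ hΦ T : Measure K) A = ENNReal.ofReal (volume.real {t ∈ Icc 0 T | Φ t ∈ A} / T) := by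
  have hT0 : 0 < T := by linarith
  rw [occupation, ProbabilityMeasure.toMeasure_map, Measure.map_apply hΦ hA, timeUniform,
    ProbabilityMeasure.coe_mk, max_eq_left hT, Measure.smul_apply,
    Measure.restrict_apply (hΦ hA), smul_eq_mul, measureReal_def, ENNReal.ofReal_div_of_pos hT0,
    ENNReal.ofReal_toReal, ENNReal.div_eq_inv_mul]
  · congr 2
    ext t
    simp [and_comm]
  · exact ((measure_mono (sep_subset _ _)).trans_lt (by simp)).ne

theorem integral_occupation (Φ : ℝ → K) (hΦ : Measurable Φ) {T : ℝ} (hT : 1 ≤ T) {g : K → ℂ}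
    (hg : Measurable g) :
    ∫ x, g x ∂(occupation Φ hΦ T : Measure K) = (T : ℂ)⁻¹ * ∫ t in Icc 0 T, g (Φ t) := by
  rw [occupation, ProbabilityMeasure.toMeasure_map, integral_map hΦ.aemeasurable
    hg.aestronglyMeasurable, timeUniform, ProbabilityMeasure.coe_mk, max_eq_left hT,
    integral_smul_measure, ENNReal.toReal_inv, ENNReal.toReal_ofReal (by linarith)]
  simp

theorem occupation_map {K' : Type*} [MeasurableSpace K'] (Φ : ℝ → K) (hΦ : Measurable Φ)
    {p : K → K'} (hp : Measurable p) (T : ℝ) :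
    (occupation Φ hΦ T).map hp.aemeasurable = occupation (p ∘ Φ) (hp.comp hΦ) T := by
  apply Subtype.ext
  simp only [occupation, ProbabilityMeasure.val_eq_to_measure, ProbabilityMeasure.toMeasure_map]
  exact Measure.map_map hp hΦ

/-- Time averages of a bounded function and of its translate agree in the limit. -/
theorem tendsto_average_shift (u : ℝ → ℂ) (hu : Measurable u) {C : ℝ} (hC : ∀ t, ‖u t‖ ≤ C)
    {τ : ℝ} (hτ : 0 ≤ τ) :
    Tendsto (fun T : ℝ => (T : ℂ)⁻¹ * (∫ t in Icc 0 T, u (t + τ)) -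
      (T : ℂ)⁻¹ * ∫ t in Icc 0 T, u t) atTop (𝓝 0) := by
  have hint : ∀ a b : ℝ, IntervalIntegrable u volume a b := fun a b => by
    refine (intervalIntegrable_const (c := C)).mono_fun' hu.aestronglyMeasurable
      (Eventually.of_forall hC)
  have hbound : ∀ a : ℝ, ‖∫ t in a..a + τ, u t‖ ≤ C * τ := by
    intro a
    have := intervalIntegral.norm_integral_le_of_norm_le_const (a := a) (b := a + τ) (f := u)
      (C := C) fun t _ => hC t
    simpa [abs_of_nonneg hτ] using this
  rw [tendsto_zero_iff_norm_tendsto_zero]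
  have hlim : Tendsto (fun T : ℝ => (C * τ + C * τ) * T⁻¹) atTop (𝓝 0) := by
    simpa using tendsto_inv_atTop_zero.const_mul (C * τ + C * τ)
  refine squeeze_zero' (Eventually.of_forall fun _ => norm_nonneg _) ?_ hlim
  filter_upwards [eventually_gt_atTop 0] with T hT
  rw [integral_Icc_eq_integral_Ioc, integral_Icc_eq_integral_Ioc,
    ← intervalIntegral.integral_of_le hT.le, ← intervalIntegral.integral_of_le hT.le,
    intervalIntegral.integral_comp_add_right, ← mul_sub, norm_mul, mul_comm, zero_add]
  -- The two windows differ only by end pieces of length τ, whose contribution is bounded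
  -- independently of T.
  have e : (∫ t in τ..T + τ, u t) - ∫ t in (0:ℝ)..T, u t =
      (∫ t in T..T + τ, u t) - ∫ t in (0:ℝ)..0 + τ, u t := by
    rw [zero_add]
    have h1 := intervalIntegral.integral_add_adjacent_intervals (hint 0 T) (hint T (T + τ))
    have h2 := intervalIntegral.integral_add_adjacent_intervals (hint 0 τ) (hint τ (T + τ))
    rw [← h1] at h2
    linear_combination h2
  rw [e, norm_inv, Complex.norm_real, Real.norm_eq_abs, abs_of_pos hT]
  gcongr
  exact (norm_sub_le _ _).trans (add_le_add (hbound T) (hbound 0))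

/-- A limit of occupation measures does not distinguish test functions `g` and `h` such that
`h` at time `t + τ` equals `g` at time `t`. -/
theorem integral_eq_of_tendsto_occupation [TopologicalSpace K] [BorelSpace K]
    (Φ : ℝ → K) (hΦ : Measurable Φ) {l : Filter ℝ} [l.NeBot] (hl : l ≤ atTop)
    {ν : ProbabilityMeasure K} (hν : Tendsto (occupation Φ hΦ) l (𝓝 ν))
    (g h : BoundedContinuousFunction K ℂ) {τ : ℝ} (hτ : 0 ≤ τ)
    (hgh : ∀ t, 0 ≤ t → h (Φ (t + τ)) = g (Φ t)) :
    ∫ x, h x ∂(ν : Measure K) = ∫ x, g x ∂(ν : Measure K) := by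
  have hlim := (ProbabilityMeasure.tendsto_iff_forall_integral_rclike_tendsto ℂ).1 hν
  have h0 := (tendsto_average_shift (fun t => h (Φ t)) (h.continuous.measurable.comp hΦ)
    (fun t => h.norm_coe_le_norm _) hτ).mono_left hl
  have h1 : Tendsto (fun T => ∫ x, g x ∂(occupation Φ hΦ T : Measure K) -
      ∫ x, h x ∂(occupation Φ hΦ T : Measure K)) l (𝓝 0) := by
    refine h0.congr' ?_
    filter_upwards [hl (eventually_ge_atTop 1)] with T hT
    rw [integral_occupation Φ hΦ hT g.continuous.measurable,
      integral_occupation Φ hΦ hT h.continuous.measurable]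
    congr 2
    exact setIntegral_congr_fun measurableSet_Icc fun t ht => hgh t ht.1
  have h2 := tendsto_nhds_unique h1 ((hlim g).sub (hlim h))
  exact (sub_eq_zero.1 h2.symm).symm

/-- In a compact space of measures, a family converges if it has only one possible limit. -/
theorem tendsto_of_forall_limit_eq [TopologicalSpace K] [BorelSpace K] [T2Space K] [CompactSpace K]
    {Ψ : ℝ → ProbabilityMeasure K} {μ : ProbabilityMeasure K} {l : Filter ℝ}
    (h : ∀ U : Ultrafilter ℝ, (U : Filter ℝ) ≤ l → ∀ ν, Tendsto Ψ U (𝓝 ν) → ν = μ) :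
    Tendsto Ψ l (𝓝 μ) := by
  rw [tendsto_iff_ultrafilter]
  intro U hU
  -- Compactness of the space of probability measures gives every ultrafilter a limit, which the
  -- hypothesis then identifies.
  obtain ⟨ν, -, hν⟩ := isCompact_univ.ultrafilter_le_nhds (U.map Ψ) (by simp)
  have hν' : Tendsto Ψ U (𝓝 ν) := hν
  rwa [← h U hU ν hν']

end Occupation

/-- An open set of a metric space is the set of nonzeros of a continuous function. -/
theorem IsOpen.exists_continuous_ne_zero_iff {X : Type*} [PseudoMetricSpace X] {W : Set X}
    (hW : IsOpen W) : ∃ ψ : C(X, ℝ), ∀ x, ψ x ≠ 0 ↔ x ∈ W := by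
  rcases Wᶜ.eq_empty_or_nonempty with h | h
  · exact ⟨1, fun x => by simp [compl_empty_iff.1 h]⟩
  · refine ⟨⟨fun x => Metric.infDist x Wᶜ, Metric.continuous_infDist_pt _⟩, fun x => ?_⟩
    rw [ContinuousMap.coe_mk, ne_eq, ← hW.isClosed_compl.mem_iff_infDist_zero h, notMem_compl_iff]

open ProbabilityTheory

/-! ### Fourier coefficients along the circle fibres -/

section Sheets

variable {ι : Type*} [MeasurableSpace ι]

/-- The `k`-th Fourier coefficient, along the circle over the point `x` of the sheet `i`, of a
measure on `card ι` copies of the three-dimensional torus. -/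
noncomputable def fiberCoeff (ν : Measure ((ι × UnitAddTorus (Fin 2)) × UnitAddCircle))
    [IsFiniteMeasure ν] (k : ℤ) (i : ι) (x : UnitAddTorus (Fin 2)) : ℂ :=
  ∫ z, fourier k z ∂(ν.condKernel (i, x))

theorem stronglyMeasurable_fiberCoeff (ν : Measure ((ι × UnitAddTorus (Fin 2)) × UnitAddCircle))
    [IsProbabilityMeasure ν] (k : ℤ) (i : ι) :
    StronglyMeasurable (fiberCoeff ν k i) := by
  have h : StronglyMeasurable fun b => ∫ z, fourier k z ∂(ν.condKernel b) :=
    StronglyMeasurable.integral_kernel (fourier (T := 1) k).continuous.stronglyMeasurable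
  exact h.comp_measurable measurable_prodMk_left

theorem norm_fiberCoeff_le (ν : Measure ((ι × UnitAddTorus (Fin 2)) × UnitAddCircle))
    [IsProbabilityMeasure ν] (k : ℤ) (i : ι) (x : UnitAddTorus (Fin 2)) :
    ‖fiberCoeff ν k i x‖ ≤ 1 := by
  refine (norm_integral_le_of_norm_le_const (C := 1) (Eventually.of_forall fun z => ?_)).trans ?_
  · exact ((fourier k).norm_coe_le_norm z).trans (fourier_norm k).le
  · simp

/-- The curve that moves with constant velocity in the three-dimensional torus and has the
itinerary `I`. -/
def sheetCurve (I : ℝ → ι) (x₀ v : Fin 2 → ℝ) (z₀ w : ℝ) (t : ℝ) :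
    (ι × UnitAddTorus (Fin 2)) × UnitAddCircle :=
  ((I t, torusMk (x₀ + t • v)), ((z₀ + t * w : ℝ) : UnitAddCircle))

theorem measurable_sheetCurve {I : ℝ → ι} (hI : Measurable I) (x₀ v : Fin 2 → ℝ) (z₀ w : ℝ) :
    Measurable (sheetCurve I x₀ v z₀ w) := by
  refine (hI.prodMk ?_).prodMk ?_
  · exact (continuous_torusMk.comp (by fun_prop)).measurable
  · exact ((AddCircle.continuous_mk' 1).comp (by fun_prop)).measurable

/-- The uniform distribution on `card ι` copies of the torus. -/
noncomputable def sheetUniform (ι : Type*) [Fintype ι] [MeasurableSpace ι] : Measure (ι × UnitAddTorus (Fin 2)) :=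
  ((Fintype.card ι : ENNReal)⁻¹ • Measure.count).prod volume

end Sheets

section Core

variable {ι : Type*} [Fintype ι] [TopologicalSpace ι] [DiscreteTopology ι]
  [MeasurableSpace ι] [BorelSpace ι]

theorem sheetUniform_singleton_prod (i : ι) (A : Set (UnitAddTorus (Fin 2))) :
    sheetUniform ι ({i} ×ˢ A) = (Fintype.card ι : ENNReal)⁻¹ * volume A := by
  rw [sheetUniform, Measure.prod_prod]
  simp

theorem integral_sheetUniform (g : ι × UnitAddTorus (Fin 2) → ℂ)
    (hg : Integrable g (sheetUniform ι)) :
    ∫ b, g b ∂(sheetUniform ι) = (Fintype.card ι : ℂ)⁻¹ * ∑ i, ∫ x, g (i, x) := by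
  rw [sheetUniform, integral_prod _ hg, integral_smul_measure, integral_count]
  simp

theorem ae_sheetUniform {p : ι × UnitAddTorus (Fin 2) → Prop} (h : ∀ i, ∀ᵐ x, p (i, x)) :
    ∀ᵐ b ∂(sheetUniform ι), p b := by
  have e : {b | ¬ p b} = ⋃ i, ({i} : Set ι) ×ˢ {x | ¬ p (i, x)} := by
    ext ⟨i, x⟩; simp
  rw [ae_iff, e, measure_iUnion_null_iff]
  intro i
  rw [sheetUniform_singleton_prod]
  rw [ae_iff.1 (h i), mul_zero]

variable [Nonempty ι]

instance : IsProbabilityMeasure (sheetUniform ι) := by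
  have : IsProbabilityMeasure ((Fintype.card ι : ENNReal)⁻¹ • (Measure.count : Measure ι)) := by
    constructor
    simp only [Measure.smul_apply, smul_eq_mul, Measure.count_univ, ENat.card_eq_coe_fintype_card]
    exact ENNReal.inv_mul_cancel (by simp) (by simp)
  rw [sheetUniform]
  infer_instance

-- Disintegration over the known marginal `sheetUniform ι`: testing ν against a function on one
-- sheet times a character of the circle amounts to testing `fiberCoeff` against that function. This
-- converts weak limits into statements about fibre coefficients.
open Classical in
theorem integral_sheet_mul_fourier (ν : Measure ((ι × UnitAddTorus (Fin 2)) × UnitAddCircle))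
    [IsProbabilityMeasure ν] (hν : ν.fst = sheetUniform ι) (i : ι)
    (A : C(UnitAddTorus (Fin 2), ℂ)) (k : ℤ) :
    ∫ p, (if p.1.1 = i then A p.1.2 else 0) * fourier k p.2 ∂ν =
      (Fintype.card ι : ℂ)⁻¹ * ∫ x, A x * fiberCoeff ν k i x := by
  have hc : Continuous fun b : ι × UnitAddTorus (Fin 2) => if b.1 = i then A b.2 else 0 := by
    have : (fun b : ι × UnitAddTorus (Fin 2) => if b.1 = i then A b.2 else 0) =
        fun b => (if b.1 = i then (1 : ℂ) else 0) * A b.2 := by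
      ext b; split_ifs <;> simp
    rw [this]
    exact ((continuous_of_discreteTopology (f := fun j : ι => if j = i then (1 : ℂ) else 0)).comp
      continuous_fst).mul (by fun_prop)
  have hb : ∀ b : ι × UnitAddTorus (Fin 2), ‖if b.1 = i then A b.2 else 0‖ ≤ ‖A‖ := by
    intro b
    split_ifs
    · exact A.norm_coe_le_norm _
    · simp
  have hint : Integrable (fun p : (ι × UnitAddTorus (Fin 2)) × UnitAddCircle =>
      (if p.1.1 = i then A p.1.2 else 0) * fourier k p.2) ν := by
    refine Integrable.of_bound ((hc.comp continuous_fst).mul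
      ((fourier k).continuous.comp continuous_snd)).aestronglyMeasurable (‖A‖ * 1)
      (Eventually.of_forall fun p => ?_)
    rw [norm_mul]
    exact mul_le_mul (hb _) (((fourier k).norm_coe_le_norm _).trans (fourier_norm k).le)
      (norm_nonneg _) (norm_nonneg _)
  rw [← Measure.integral_condKernel hint, hν]
  simp_rw [integral_const_mul]
  rw [integral_sheetUniform]
  · rw [Finset.sum_eq_single i]
    · simp [fiberCoeff]
    · intro j _ hj
      simp [hj]
    · simp
  · refine Integrable.of_bound (hc.aestronglyMeasurable.mul ?_) (‖A‖ * 1)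
      (Eventually.of_forall fun b => ?_)
    · exact (StronglyMeasurable.integral_kernel
        (fourier (T := 1) k).continuous.stronglyMeasurable).aestronglyMeasurable
    · rw [norm_mul]
      exact mul_le_mul (hb _) (norm_fiberCoeff_le ν k b.1 b.2) (norm_nonneg _) (norm_nonneg _)

open Classical in
/-- If the points of the open set `W` move from the sheet `i` to the sheet `σ i` in time `τ`, then
the fibre coefficients of a limit of occupation measures are equivariant on `W`. -/
theorem ae_fiberCoeff_shift {I : ℝ → ι} (hI : Measurable I) (x₀ v : Fin 2 → ℝ) (z₀ w : ℝ)
    {l : Filter ℝ} [l.NeBot] (hl : l ≤ atTop)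
    {ν : ProbabilityMeasure ((ι × UnitAddTorus (Fin 2)) × UnitAddCircle)}
    (hν : Tendsto (occupation (sheetCurve I x₀ v z₀ w) (measurable_sheetCurve hI x₀ v z₀ w)) l
      (𝓝 ν)) (hfst : ν.toMeasure.fst = sheetUniform ι) (k : ℤ)
    {W : Set (UnitAddTorus (Fin 2))} (hW : IsOpen W) (σ : Equiv.Perm ι) {τ : ℝ} (hτ : 0 ≤ τ)
    (hσ : ∀ t, 0 ≤ t → torusMk (x₀ + t • v) ∈ W → I (t + τ) = σ (I t)) :
    ∀ᵐ x, x ∈ W → ∀ i, fiberCoeff ν.toMeasure k (σ i) (x + torusMk (τ • v)) =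
      Complex.exp (((2 * Real.pi * k * w * τ : ℝ) : ℂ) * Complex.I) *
        fiberCoeff ν.toMeasure k i x := by
  -- Limits of measures see only continuous test functions, so the indicator of `W` is replaced by a
  -- continuous ψ that is nonzero exactly on `W`.
  obtain ⟨ψ, hψ⟩ := hW.exists_continuous_ne_zero_iff
  set s : UnitAddTorus (Fin 2) := torusMk (τ • v) with hs
  set e : ℂ := Complex.exp (((2 * Real.pi * k * w * τ : ℝ) : ℂ) * Complex.I) with he
  have he0 : e ≠ 0 := Complex.exp_ne_zero _
  have hshift : ∀ z : ℝ, fourier k ((z + τ * w : ℝ) : UnitAddCircle) =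
      fourier k (z : UnitAddCircle) * e := by
    intro z
    rw [fourier_coe_apply, fourier_coe_apply, he, ← Complex.exp_add]
    congr 1
    push_cast
    ring
  suffices H : ∀ i, ∀ᵐ x, (ψ x : ℂ) * (e⁻¹ * fiberCoeff ν.toMeasure k (σ i) (x + s) -
      fiberCoeff ν.toMeasure k i x) = 0 by
    filter_upwards [ae_all_iff.2 H] with x hx hxW i
    have h0 : (ψ x : ℂ) ≠ 0 := by exact_mod_cast (hψ x).2 hxW
    have h1 := (mul_eq_zero.1 (hx i)).resolve_left h0
    have h2 := sub_eq_zero.1 h1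
    rw [← h2, mul_inv_cancel_left₀ he0]
  intro i
  have hmeas : AEStronglyMeasurable (fun x => (ψ x : ℂ) *
      (e⁻¹ * fiberCoeff ν.toMeasure k (σ i) (x + s) - fiberCoeff ν.toMeasure k i x))
      volume := by
    refine AEStronglyMeasurable.mul (Complex.continuous_ofReal.comp ψ.continuous).aestronglyMeasurable ?_
    refine AEStronglyMeasurable.sub (AEStronglyMeasurable.const_mul ?_ _)
      (stronglyMeasurable_fiberCoeff _ k i).aestronglyMeasurable
    exact (stronglyMeasurable_fiberCoeff _ k (σ i)).aestronglyMeasurable.comp_measurePreserving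
      (measurePreserving_add_right volume s)
  have hnorm : ‖e⁻¹‖ = 1 := by
    rw [norm_inv, he, Complex.norm_exp_ofReal_mul_I, inv_one]
  refine ae_eq_zero_of_integral_mFourier_mul_eq_zero _ hmeas (‖ψ‖ * (1 * 1 + 1)) (fun x => ?_)
    fun m => ?_
  · rw [norm_mul]
    refine mul_le_mul ?_ ((norm_sub_le _ _).trans (add_le_add ?_ (norm_fiberCoeff_le _ _ _ _)))
      (norm_nonneg _) (norm_nonneg _)
    · simpa using ψ.norm_coe_le_norm x
    · rw [norm_mul, hnorm]
      exact mul_le_mul le_rfl (norm_fiberCoeff_le _ _ _ _) (norm_nonneg _) zero_le_one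
  -- `A` is tested on sheet `i` and its translate `B` on sheet `σ i`, with the factor `e⁻¹` that
  -- cancels the rotation of the circle during time τ. Along the curve the second test function at
  -- time `t + τ` then equals the first at time `t`.
  let A : C(UnitAddTorus (Fin 2), ℂ) := ⟨fun x => UnitAddTorus.mFourier m x * ψ x, by fun_prop⟩
  let B : C(UnitAddTorus (Fin 2), ℂ) := ⟨fun x => A (x - s), by fun_prop⟩
  have hcont : ∀ (j : ι) (A : C(UnitAddTorus (Fin 2), ℂ)), Continuous
      fun p : (ι × UnitAddTorus (Fin 2)) × UnitAddCircle =>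
        (if p.1.1 = j then A p.1.2 else 0) * fourier k p.2 := by
    intro j A
    refine Continuous.mul ?_ (by fun_prop)
    have : (fun p : (ι × UnitAddTorus (Fin 2)) × UnitAddCircle => if p.1.1 = j then A p.1.2 else 0)
        = fun p => (if p.1.1 = j then (1 : ℂ) else 0) * A p.1.2 := by
      ext b; split_ifs <;> simp
    rw [this]
    exact ((continuous_of_discreteTopology (f := fun j' : ι => if j' = j then (1 : ℂ) else 0)).comp
      (continuous_fst.comp continuous_fst)).mul (by fun_prop)
  let g := BoundedContinuousFunction.mkOfCompact (⟨_, hcont i A⟩ : C(_, ℂ))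
  let h := BoundedContinuousFunction.mkOfCompact
    (⟨fun p : (ι × UnitAddTorus (Fin 2)) × UnitAddCircle => (if p.1.1 = σ i
      then B p.1.2 else 0) * fourier k p.2 * e⁻¹,
      (hcont (σ i) B).mul (continuous_const (y := e⁻¹))⟩ : C(_, ℂ))
  have key := integral_eq_of_tendsto_occupation _ _ hl hν g h hτ (fun t ht => by
    simp only [g, h, BoundedContinuousFunction.mkOfCompact_apply, ContinuousMap.coe_mk, sheetCurve]
    have e1 : torusMk (x₀ + (t + τ) • v) = torusMk (x₀ + t • v) + s := by
      rw [hs, ← torusMk_add, add_smul, add_assoc]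
    have e2 : z₀ + (t + τ) * w = (z₀ + t * w) + τ * w := by ring
    rw [e1, e2, hshift]
    have e3 : B (torusMk (x₀ + t • v) + s) = A (torusMk (x₀ + t • v)) := by
      simp [B]
    rw [e3]
    -- Inside `W` the sheet changes by σ; outside, the sheet may do anything, but both values vanish
    -- with ψ.
    by_cases hx : torusMk (x₀ + t • v) ∈ W
    · rw [hσ t ht hx]
      simp only [EmbeddingLike.apply_eq_iff_eq]
      field_simp
    · have : ψ (torusMk (x₀ + t • v)) = 0 := by
        by_contra h0
        exact hx ((hψ _).1 h0)
      simp [A, this])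
  simp only [g, h, BoundedContinuousFunction.mkOfCompact_apply, ContinuousMap.coe_mk] at key
  rw [integral_mul_const, integral_sheet_mul_fourier _ hfst, integral_sheet_mul_fourier _ hfst] at key
  have hcard : (Fintype.card ι : ℂ)⁻¹ ≠ 0 := by simp
  have hBA : ∫ x, B x * fiberCoeff ν.toMeasure k (σ i) x =
      ∫ x, A x * fiberCoeff ν.toMeasure k (σ i) (x + s) := by
    rw [← integral_add_right_eq_self _ s]
    simp [B]
  rw [hBA, mul_assoc] at key
  have key2 := mul_left_cancel₀ hcard key
  have hintA : ∀ G : UnitAddTorus (Fin 2) → ℂ, AEStronglyMeasurable G volume → (∀ x, ‖G x‖ ≤ 1) →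
      Integrable (fun x => A x * G x) volume := fun G hG hG1 =>
    Integrable.of_bound (A.continuous.aestronglyMeasurable.mul hG) (‖A‖ * 1)
      (Eventually.of_forall fun x => by
        rw [norm_mul]
        exact mul_le_mul (A.norm_coe_le_norm x) (hG1 x) (norm_nonneg _) (norm_nonneg _))
  calc ∫ x, UnitAddTorus.mFourier m x * ((ψ x : ℂ) *
        (e⁻¹ * fiberCoeff ν.toMeasure k (σ i) (x + s) - fiberCoeff ν.toMeasure k i x))
      = ∫ x, (A x * fiberCoeff ν.toMeasure k (σ i) (x + s) * e⁻¹ -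
          A x * fiberCoeff ν.toMeasure k i x) := by
        refine integral_congr_ae (Eventually.of_forall fun x => ?_)
        simp only [A, ContinuousMap.coe_mk]
        ring
    _ = 0 := by
        rw [integral_sub, integral_mul_const, key2, sub_self]
        · refine (hintA _ ?_ fun x => norm_fiberCoeff_le _ _ _ _).mul_const _
          exact (stronglyMeasurable_fiberCoeff _ k (σ i)).aestronglyMeasurable.comp_measurePreserving
            (measurePreserving_add_right volume s)
        · exact hintA _ (stronglyMeasurable_fiberCoeff _ k i).aestronglyMeasurable
            fun x => norm_fiberCoeff_le _ _ _ _

end Core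

/-! ### The unit cube as a fundamental domain, and transition sets -/

/-- The open unit cube. -/
def openCell (n : ℕ) : Set (Fin n → ℝ) := Set.pi univ fun _ => Ioo 0 1

theorem isOpen_openCell (n : ℕ) : IsOpen (openCell n) :=
  isOpen_set_pi finite_univ fun _ _ => isOpen_Ioo

theorem torusMk_eq_iff {n : ℕ} {x y : Fin n → ℝ} :
    torusMk x = torusMk y ↔ ∃ a : Fin n → ℤ, x = y + fun d => (a d : ℝ) := by
  have h : ∀ d, ((x d : UnitAddCircle) = (y d : UnitAddCircle)) ↔ ∃ a : ℤ, x d = y d + a := by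
    intro d
    rw [← sub_eq_zero, ← AddCircle.coe_sub, AddCircle.coe_eq_zero_iff]
    refine exists_congr fun a => ?_
    rw [zsmul_one, eq_sub_iff_add_eq, eq_comm, add_comm]
  rw [funext_iff]
  simp only [torusMk, h]
  rw [Classical.skolem]
  simp only [funext_iff, Pi.add_apply]

theorem volume_restrict_openCell (n : ℕ) :
    (volume : Measure (Fin n → ℝ)).restrict (Set.pi univ fun _ => Ioc 0 1) =
      volume.restrict (openCell n) := by
  refine Measure.restrict_congr_set ?_
  exact (Measure.univ_pi_Ioo_ae_eq_Icc.trans Measure.univ_pi_Ioc_ae_eq_Icc.symm).symm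

theorem measurePreserving_torusMk (n : ℕ) :
    MeasurePreserving (torusMk (n := n)) (volume.restrict (openCell n)) volume := by
  rw [← volume_restrict_openCell, volume_pi, Measure.restrict_pi_pi]
  have := fun _ : Fin n => AddCircle.measurePreserving_mk 1 0
  rw [zero_add] at this
  exact measurePreserving_pi _ _ this

/-- Only one of two points with the same image has to lie in the fundamental domain `C`, so `A` may
contain boundary points that `p` identifies with one another. -/
theorem measure_image_of_measurePreserving {Y Z : Type*} [MeasurableSpace Y] [MeasurableSpace Z]
    {μ : Measure Y} {ρ : Measure Z} {p : Y → Z} {C : Set Y}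
    (hp : MeasurePreserving p (μ.restrict C) ρ) {A : Set Y}
    (hinj : ∀ y ∈ C, ∀ y' ∈ A, p y = p y' → y = y') (hA : MeasurableSet (p '' A))
    (hAC : A ≤ᵐ[μ] C) (hpm : Measurable p) : ρ (p '' A) = μ A := by
  rw [← hp.measure_preimage hA.nullMeasurableSet, Measure.restrict_apply (hpm hA)]
  have e : p ⁻¹' (p '' A) ∩ C = A ∩ C := by
    ext y
    constructor
    · rintro ⟨⟨y', hy', h⟩, hy⟩
      rw [hinj y hy y' hy' h.symm]
      exact ⟨hy', hinj y hy y' hy' h.symm ▸ hy⟩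
    · rintro ⟨h1, h2⟩
      exact ⟨mem_image_of_mem p h1, h2⟩
  rw [e]
  refine measure_congr ?_
  filter_upwards [hAC] with y hy
  exact propext ⟨fun h => h.1, fun h => ⟨h, hy h⟩⟩

/-- The difference is an integer vector whose entries lie strictly between -1 and 1, as one point is
interior. The other point may lie on the boundary. -/
theorem torusMk_injOn_openCell {n : ℕ} {x y : Fin n → ℝ} (hx : x ∈ openCell n)
    (hy : y ∈ Icc (0 : Fin n → ℝ) 1) (h : torusMk x = torusMk y) : x = y := by
  obtain ⟨a, ha⟩ := torusMk_eq_iff.1 h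
  have : ∀ d, a d = 0 := by
    intro d
    have h1 := congrFun ha d
    have h2 := hx d trivial
    have h3 := hy.1 d
    have h4 := hy.2 d
    simp only [Pi.add_apply, Pi.zero_apply, Pi.one_apply, mem_Ioo] at h1 h2 h3 h4
    have h5 : (-1 : ℝ) < a d := by linarith
    have h6 : (a d : ℝ) < 1 := by linarith
    have h7 : -1 < a d := by exact_mod_cast h5
    have h8 : a d < 1 := by exact_mod_cast h6
    omega
  rw [ha]
  ext d
  simp [this]

/-- The points of the torus that are represented by a point `y` of the open unit cube such that
`y + u` is in the translate of the open unit cube by `a`. -/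
def transitionSet {n : ℕ} (u : Fin n → ℝ) (a : Fin n → ℤ) : Set (UnitAddTorus (Fin n)) :=
  torusMk '' {y | y ∈ openCell n ∧ y + u - (fun d => (a d : ℝ)) ∈ openCell n}

theorem isOpen_transitionSet {n : ℕ} (u : Fin n → ℝ) (a : Fin n → ℤ) :
    IsOpen (transitionSet u a) := by
  refine isOpenMap_torusMk _ ((isOpen_openCell n).inter ?_)
  exact (isOpen_openCell n).preimage (by fun_prop)

instance : NullSingletonClass (volume : Measure UnitAddCircle) := ⟨fun c => by
  rw [← Metric.closedBall_zero, AddCircle.volume_closedBall]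
  simp⟩

theorem ae_torus_ne {n : ℕ} (c : UnitAddCircle) (d : Fin n) :
    ∀ᵐ x : UnitAddTorus (Fin n), x d ≠ c := by
  rw [ae_iff]
  simp only [ne_eq, not_not]
  exact Measure.pi_hyperplane (fun _ : Fin n => (volume : Measure UnitAddCircle)) d c

/-- Up to a null set, the torus is covered by the transition sets of the displacements that move
by at most one cube, in the direction of `u`, in each coordinate. -/
theorem ae_exists_mem_transitionSet {n : ℕ} {u : Fin n → ℝ} {ε : Fin n → ℤ}
    (hε : ∀ d, (0 < u d ∧ u d < 1 ∧ ε d = 1) ∨ (u d < 0 ∧ -1 < u d ∧ ε d = -1)) :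
    ∀ᵐ x, ∃ a : Fin n → ℤ, (∀ d, a d = 0 ∨ a d = ε d) ∧ x ∈ transitionSet u a := by
  have h1 := ae_all_iff.2 fun d : Fin n => ae_torus_ne 0 d
  -- This null set contains the points whose translate by `u` lands on a face.
  have h2 := ae_all_iff.2 fun d : Fin n => ae_torus_ne ((-u d : ℝ) : UnitAddCircle) d
  filter_upwards [h1, h2] with x hx hxu
  have hrep : ∀ d, ∃ y : ℝ, y ∈ Ioo (0 : ℝ) 1 ∧ (y : UnitAddCircle) = x d := by
    intro d
    obtain ⟨y, hy⟩ := QuotientAddGroup.mk_surjective (x d)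
    have hy' : ((Int.fract y : ℝ) : UnitAddCircle) = x d := by
      rw [← hy, eq_comm]
      rw [← sub_eq_zero, ← AddCircle.coe_sub, AddCircle.coe_eq_zero_iff]
      exact ⟨⌊y⌋, by simp⟩
    refine ⟨Int.fract y, ⟨lt_of_le_of_ne (Int.fract_nonneg y) fun h => hx d ?_,
      Int.fract_lt_one y⟩, hy'⟩
    rw [← hy', ← h, AddCircle.coe_zero]
  choose y hy hyx using hrep
  have hint : ∀ (d) (a : ℤ), y d + u d ≠ a := by
    intro d a h
    apply hxu d
    rw [← hyx, ← sub_eq_zero, ← AddCircle.coe_sub, AddCircle.coe_eq_zero_iff]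
    exact ⟨a, by rw [zsmul_one, ← h]; ring⟩
  have ha : ∀ d, ∃ a : ℤ, (a = 0 ∨ a = ε d) ∧ y d + u d - a ∈ Ioo (0 : ℝ) 1 := by
    intro d
    obtain ⟨hy0, hy1⟩ := hy d
    have i0 := hint d 0
    have i1 := hint d 1
    push_cast at i0 i1
    rcases hε d with ⟨hu, hu1, he⟩ | ⟨hu, hu1, he⟩
    · rcases lt_or_gt_of_ne i1 with h | h
      · exact ⟨0, Or.inl rfl, by push_cast; constructor <;> linarith⟩
      · exact ⟨1, Or.inr he.symm, by push_cast; constructor <;> linarith⟩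
    · rcases lt_or_gt_of_ne i0 with h | h
      · exact ⟨-1, Or.inr he.symm, by push_cast; constructor <;> linarith⟩
      · exact ⟨0, Or.inl rfl, by push_cast; constructor <;> linarith⟩
  choose a ha1 ha2 using ha
  exact ⟨a, ha1, y, ⟨fun d _ => hy d, fun d _ => ha2 d⟩, funext hyx⟩

/-- To leave the cube in every coordinate, a point must be within `|u d|` of the face ahead for each
`d`, hence in a box at one corner. For `u = τ • v` in the plane this is the O(τ²) bound on the
discarded set. -/
theorem volume_transitionSet_le {n : ℕ} {u : Fin n → ℝ} {ε : Fin n → ℤ}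
    (hε : ∀ d, (0 < u d ∧ ε d = 1) ∨ (u d < 0 ∧ ε d = -1)) :
    volume.real (transitionSet u ε) ≤ ∏ d, |u d| := by
  set A := {y | y ∈ openCell n ∧ y + u - (fun d => (ε d : ℝ)) ∈ openCell n} with hA
  have hAC : A ⊆ openCell n := fun y hy => hy.1
  have h1 : volume (transitionSet u ε) ≤ volume A := by
    have hm := (isOpen_transitionSet u ε).measurableSet
    rw [← (measurePreserving_torusMk n).measure_preimage hm.nullMeasurableSet,
      Measure.restrict_apply (continuous_torusMk.measurable hm)]
    refine measure_mono ?_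
    rintro y ⟨⟨y', hy', h⟩, hy⟩
    have hy'' : y' ∈ Icc (0 : Fin n → ℝ) 1 :=
      ⟨fun d => (hy'.1 d trivial).1.le, fun d => (hy'.1 d trivial).2.le⟩
    rwa [torusMk_injOn_openCell hy hy'' h.symm]
  have h2 : A ⊆ Set.pi univ fun d => Ioo (if 0 < u d then 1 - u d else 0)
      (if 0 < u d then 1 else - u d) := by
    rintro y ⟨hy1, hy2⟩ d -
    have e1 := hy1 d trivial
    have e2 := hy2 d trivial
    simp only [Pi.add_apply, Pi.sub_apply, mem_Ioo] at e1 e2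
    rcases hε d with ⟨hu, he⟩ | ⟨hu, he⟩
    · rw [he] at e2
      push_cast at e2
      simp only [hu, if_true, mem_Ioo]
      constructor <;> linarith
    · rw [he] at e2
      push_cast at e2
      simp only [not_lt.2 hu.le, if_false, mem_Ioo]
      constructor <;> linarith
  have h3 : volume (transitionSet u ε) ≤ ENNReal.ofReal (∏ d, |u d|) := by
    refine (h1.trans (measure_mono h2)).trans ?_
    rw [Real.volume_pi_Ioo, ENNReal.ofReal_prod_of_nonneg fun d _ => abs_nonneg _]
    refine le_of_eq (Finset.prod_congr rfl fun d _ => ?_)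
    congr 1
    rcases hε d with ⟨hu, he⟩ | ⟨hu, he⟩
    · simp [hu, abs_of_pos hu]
    · simp [not_lt.2 hu.le, abs_of_neg hu]
  exact ENNReal.toReal_le_of_le_ofReal (Finset.prod_nonneg fun d _ => abs_nonneg _) h3

/-! ### Limits of occupation measures are uniform -/

section Core

variable {ι : Type*} [Fintype ι] [TopologicalSpace ι] [DiscreteTopology ι]
  [MeasurableSpace ι] [BorelSpace ι] [Nonempty ι]

theorem linearIndependent_three {v : Fin 2 → ℝ} {w : ℝ}
    (h : LinearIndependent ℚ ![v 0, v 1, w]) (a b c : ℤ) (h0 : a * v 0 + b * v 1 + c * w = 0) :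
    a = 0 ∧ b = 0 ∧ c = 0 := by
  have h1 := Fintype.linearIndependent_iff.1 h ![(a : ℚ), b, c] (by
    simp only [Fin.sum_univ_three, Rat.smul_def]
    simpa using h0)
  exact ⟨by simpa using h1 0, by simpa using h1 1, by simpa using h1 2⟩

/-- Let a curve in copies of the torus with a Kronecker direction change sheets only by permutations
when it crosses an edge. If a limit of its occupation measures projects to the uniform
distribution on the copies of the two-dimensional torus, then it is itself uniform. -/
theorem limit_eq_uniform {I : ℝ → ι} (hI : Measurable I) (x₀ v : Fin 2 → ℝ) (z₀ w : ℝ)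
    (hlin : LinearIndependent ℚ ![v 0, v 1, w]) (ε : Fin 2 → ℤ)
    (hε : ∀ d, (0 < v d ∧ ε d = 1) ∨ (v d < 0 ∧ ε d = -1))
    (hdyn : ∀ a : Fin 2 → ℤ, (∀ d, a d = 0 ∨ a d = ε d) → (∃ d, a d = 0) → ∃ σ : Equiv.Perm ι,
      ∀ (t τ : ℝ) (b : Fin 2 → ℤ), 0 ≤ t → 0 < τ →
        x₀ + t • v - (fun d => (b d : ℝ)) ∈ openCell 2 →
        x₀ + (t + τ) • v - (fun d => (b d : ℝ)) - (fun d => (a d : ℝ)) ∈ openCell 2 →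
        I (t + τ) = σ (I t))
    {l : Filter ℝ} [l.NeBot] (hl : l ≤ atTop)
    {ν : ProbabilityMeasure ((ι × UnitAddTorus (Fin 2)) × UnitAddCircle)}
    (hν : Tendsto (occupation (sheetCurve I x₀ v z₀ w) (measurable_sheetCurve hI x₀ v z₀ w)) l
      (𝓝 ν)) (hfst : ν.toMeasure.fst = sheetUniform ι) :
    ν.toMeasure = (sheetUniform ι).prod volume := by
  have hcoeff : ∀ k : ℤ, k ≠ 0 → ∀ i, ∀ᵐ x, fiberCoeff ν.toMeasure k i x = 0 := by
    intro k hk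
    have hsum : ∀ j : ℕ, 0 < j → ∀ᵐ x, ∑ i, fiberCoeff ν.toMeasure k i x ^ j = 0 := by
      intro j hj
      -- For `τ < δ` the displacement is less than 1 in each coordinate, so at most one grid line is
      -- crossed per axis.
      obtain ⟨δ, hδ, hδv⟩ : ∃ δ : ℝ, 0 < δ ∧ ∀ d, δ * |v d| ≤ 1 := by
        refine ⟨(1 + |v 0| + |v 1|)⁻¹, by positivity, fun d => ?_⟩
        rw [inv_mul_le_one₀ (by positivity)]
        fin_cases d
        · simp only [Fin.zero_eta]; linarith [abs_nonneg (v 1)]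
        · simp only [Fin.mk_one]; linarith [abs_nonneg (v 0)]
      refine ae_eq_zero_of_eigenfunction (C := Fintype.card ι) _ ?_ (fun x => ?_) v
        (2 * Real.pi * (j * k * w)) (fun m h => ?_) (A := |v 0| * |v 1|) hδ
        (fun τ => transitionSet (τ • v) ε) (fun τ => (isOpen_transitionSet _ _).measurableSet)
        (fun τ hτ => ?_) fun τ hτ => ?_
      · exact (Finset.stronglyMeasurable_fun_sum _ fun i _ =>
          (stronglyMeasurable_fiberCoeff _ k i).pow j).aestronglyMeasurable
      · refine (norm_sum_le _ _).trans ?_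
        calc ∑ i, ‖fiberCoeff ν.toMeasure k i x ^ j‖ ≤ ∑ i : ι, (1 : ℝ) :=
              Finset.sum_le_sum fun i _ => by
                rw [norm_pow]
                exact pow_le_one₀ (norm_nonneg _) (norm_fiberCoeff_le _ _ _ _)
          _ = Fintype.card ι := by simp
      -- A resonance would be a rational relation between the coordinates of (v, w) with coefficient
      -- `-(j * k) ≠ 0` at `w`.
      · have h1 : (j * k * w : ℝ) = ∑ d, m d * v d :=
          mul_left_cancel₀ (by positivity) h
        rw [Fin.sum_univ_two] at h1
        have := (linearIndependent_three hlin (m 0) (m 1) (-(j * k)) (by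
          push_cast; linarith)).2.2
        simp only [neg_eq_zero, mul_eq_zero, Nat.cast_eq_zero] at this
        omega
      · refine (volume_transitionSet_le (fun d => ?_)).trans (le_of_eq ?_)
        · rcases hε d with ⟨h1, h2⟩ | ⟨h1, h2⟩
          · exact Or.inl ⟨mul_pos hτ.1 h1, h2⟩
          · exact Or.inr ⟨mul_neg_of_pos_of_neg hτ.1 h1, h2⟩
        · rw [Fin.prod_univ_two]
          simp only [Pi.smul_apply, smul_eq_mul, abs_mul, abs_of_pos hτ.1]
          ring
      · have hcover := ae_exists_mem_transitionSet (u := τ • v) (ε := ε) fun d => by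
          have hlt : τ * |v d| < 1 := by
            rcases (abs_nonneg (v d)).eq_or_lt with h0 | h0
            · rw [← h0]; simp
            · exact (mul_lt_mul_of_pos_right hτ.2 h0).trans_le (hδv d)
          rcases hε d with ⟨h1, h2⟩ | ⟨h1, h2⟩
          · rw [abs_of_pos h1] at hlt
            exact Or.inl ⟨mul_pos hτ.1 h1, hlt, h2⟩
          · rw [abs_of_neg h1] at hlt
            refine Or.inr ⟨mul_neg_of_pos_of_neg hτ.1 h1, ?_, h2⟩
            simp only [Pi.smul_apply, smul_eq_mul]
            linarith
        have hshift : ∀ a : Fin 2 → ℤ, ∀ᵐ x, (∀ d, a d = 0 ∨ a d = ε d) → (∃ d, a d = 0) →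
            x ∈ transitionSet (τ • v) a → ∃ σ : Equiv.Perm ι, ∀ i,
              fiberCoeff ν.toMeasure k (σ i) (x + torusMk (τ • v)) =
                Complex.exp (((2 * Real.pi * k * w * τ : ℝ) : ℂ) * Complex.I) *
                  fiberCoeff ν.toMeasure k i x := by
          intro a
          by_cases ha : (∀ d, a d = 0 ∨ a d = ε d) ∧ ∃ d, a d = 0
          · obtain ⟨σ, hσ⟩ := hdyn a ha.1 ha.2
            have := ae_fiberCoeff_shift hI x₀ v z₀ w hl hν hfst k
              (isOpen_transitionSet (τ • v) a) σ hτ.1.le fun t ht hx => by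
                obtain ⟨y, ⟨hy1, hy2⟩, hy⟩ := hx
                obtain ⟨b, hb⟩ := torusMk_eq_iff.1 hy.symm
                refine hσ t τ b ht hτ.1 ?_ ?_
                · rwa [hb, add_sub_cancel_right]
                · have : x₀ + (t + τ) • v - (fun d => (b d : ℝ)) - (fun d => (a d : ℝ)) =
                      y + τ • v - (fun d => (a d : ℝ)) := by
                    rw [add_smul, ← add_assoc, hb]
                    abel
                  rwa [this]
            filter_upwards [this] with x hx _ _ hxW
            exact ⟨σ, hx hxW⟩
          · exact Eventually.of_forall fun x h1 h2 => (ha ⟨h1, h2⟩).elim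
        filter_upwards [hcover, ae_all_iff.2 hshift] with x ⟨a, ha, hxa⟩ hx hxR
        have ha0 : ∃ d, a d = 0 := by
          -- A displacement without a zero coordinate is ε itself, the corner case that is
          -- discarded.
          by_contra! hne
          have : a = ε := funext fun d => (ha d).resolve_left (hne d)
          exact hxR (this ▸ hxa)
        obtain ⟨σ, hσ⟩ := hx a ha ha0 hxa
        -- The power sum is invariant under reindexing by σ, so it does not matter that σ depends on
        -- `x`; only the `j`-th power of the phase remains.
        rw [← Equiv.sum_comp σ, Finset.mul_sum]
        refine Finset.sum_congr rfl fun i _ => ?_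
        rw [hσ i, mul_pow, ← Complex.exp_nat_mul]
        congr 2
        push_cast
        ring
    have hall : ∀ᵐ x, ∀ j : ℕ, 0 < j → ∑ i, fiberCoeff ν.toMeasure k i x ^ j = 0 := by
      rw [ae_all_iff]
      intro j
      by_cases hj : 0 < j
      · filter_upwards [hsum j hj] with x hx _ using hx
      · exact Eventually.of_forall fun x h => (hj h).elim
    intro i
    filter_upwards [hall] with x hx
    exact eq_zero_of_sum_pow_eq_zero _ hx i
  have hkernel : ∀ᵐ b ∂(sheetUniform ι), ν.toMeasure.condKernel b = volume := by
    refine ae_sheetUniform fun i => ?_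
    have : ∀ᵐ x, ∀ k : ℤ, k ≠ 0 → fiberCoeff ν.toMeasure k i x = 0 := by
      rw [ae_all_iff]
      intro k
      by_cases hk : k = 0
      · exact Eventually.of_forall fun x h => (h hk).elim
      · filter_upwards [hcoeff k hk i] with x hx _ using hx
    filter_upwards [this] with x hx
    exact eq_volume_of_integral_fourier_eq_zero _ hx
  rw [← ν.toMeasure.disintegrate ν.toMeasure.condKernel, hfst,
    Measure.compProd_congr (η := Kernel.const _ volume), Measure.compProd_const]
  filter_upwards [hkernel] with b hb
  rw [hb, Kernel.const_apply]

end Core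

/-! ### Convergence of the occupation measures -/

section Convergence

variable {ι : Type*} [Fintype ι] [TopologicalSpace ι] [DiscreteTopology ι]
  [MeasurableSpace ι] [BorelSpace ι] [Nonempty ι]

/-- The coordinatewise fractional part. -/
noncomputable def fractPart {n : ℕ} (y : Fin n → ℝ) : Fin n → ℝ := fun d => Int.fract (y d)

theorem measurable_fractPart {n : ℕ} : Measurable (fractPart (n := n)) :=
  measurable_pi_lambda _ fun d => measurable_fract.comp (measurable_pi_apply d)

theorem torusMk_fractPart {n : ℕ} (y : Fin n → ℝ) : torusMk (fractPart y) = torusMk y := by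
  rw [torusMk_eq_iff]
  refine ⟨fun d => -⌊y d⌋, ?_⟩
  ext d
  simp only [fractPart, Pi.add_apply, Int.cast_neg]
  linarith [Int.self_sub_floor (y d)]

/-- If a curve spends in every box of every unit square the right proportion of time, then its
occupation measures converge to the uniform distribution on the copies of the torus. -/
theorem tendsto_occupation_base {I : ℝ → ι} (hI : Measurable I) (x₀ v : Fin 2 → ℝ)
    (hbase : ∀ (i : ι) (a b : Fin 2 → ℝ), Tendsto (fun T : ℝ =>
      volume.real {t ∈ Icc 0 T | I t = i ∧ fractPart (x₀ + t • v) ∈ Set.pi univ fun d =>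
        Ioo (a d) (b d)} / T) atTop
      (𝓝 (volume.real ((Set.pi univ fun d => Ioo (a d) (b d)) ∩ Icc 0 1) / Fintype.card ι)))
    (hm : Measurable fun t : ℝ => (I t, torusMk (x₀ + t • v))) :
    Tendsto (occupation (fun t : ℝ => (I t, torusMk (x₀ + t • v))) hm) atTop
      (𝓝 ⟨sheetUniform ι, inferInstance⟩) := by
  have hcard : IsProbabilityMeasure ((Fintype.card ι : ENNReal)⁻¹ • (Measure.count : Measure ι)) := by
    constructor
    simp only [Measure.smul_apply, smul_eq_mul, Measure.count_univ, ENat.card_eq_coe_fintype_card]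
    exact ENNReal.inv_mul_cancel (by simp) (by simp)
  have hcell : IsProbabilityMeasure
      ((volume : Measure (Fin 2 → ℝ)).restrict (Icc (0 : Fin 2 → ℝ) 1)) := by
    constructor
    rw [Measure.restrict_apply_univ, Real.volume_Icc_pi]
    simp
  let m : Measure (ι × (Fin 2 → ℝ)) := ((Fintype.card ι : ENNReal)⁻¹ • Measure.count).prod
    (volume.restrict (Icc (0 : Fin 2 → ℝ) 1))
  have hmp : IsProbabilityMeasure m := by
    simp only [m]; infer_instance
  let mP : ProbabilityMeasure (ι × (Fin 2 → ℝ)) := ⟨m, hmp⟩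
  have hmΦ : Measurable fun t : ℝ => (I t, fractPart (x₀ + t • v)) :=
    hI.prodMk (measurable_fractPart.comp (by fun_prop))
  -- Convergence is first proved in `ι × ℝ²`, where boxes on single sheets are a π-system containing
  -- small neighbourhoods of every point, and is then pushed forward by the continuous map to the
  -- torus.
  have hlim : Tendsto (occupation (fun t : ℝ => (I t, fractPart (x₀ + t • v))) hmΦ) atTop
      (𝓝 mP) := by
    let S : Set (Set (ι × (Fin 2 → ℝ))) :=
      {s | ∃ (i : ι) (a b : Fin 2 → ℝ), s = {i} ×ˢ Set.pi univ fun d => Ioo (a d) (b d)}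
    have hSm : ∀ s ∈ S, MeasurableSet s := by
      rintro s ⟨i, a, b, rfl⟩
      exact (measurableSet_singleton i).prod (MeasurableSet.univ_pi fun d => measurableSet_Ioo)
    refine IsPiSystem.tendsto_probabilityMeasure_of_tendsto_of_mem (S := S) ?_ hSm ?_ ?_
    · rintro _ ⟨i, a, b, rfl⟩ _ ⟨i', a', b', rfl⟩ ⟨p, hp, hp'⟩
      have h1 : p.1 = i := hp.1
      have h2 : p.1 = i' := hp'.1
      subst h1
      subst h2
      refine ⟨p.1, fun d => max (a d) (a' d), fun d => min (b d) (b' d), ?_⟩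
      rw [← prod_inter, ← pi_inter_distrib]
      simp only [Ioo_inter_Ioo]
    · rintro u hu ⟨i, y⟩ hp
      obtain ⟨u₁, u₂, h1, h2, hi, hy, hu'⟩ := isOpen_prod_iff.1 hu i y hp
      obtain ⟨r, hr, hball⟩ := Metric.isOpen_iff.1 h2 y hy
      have hpi : Metric.ball y r = Set.pi univ fun d => Ioo (y d - r) (y d + r) := by
        rw [ball_pi _ hr]
        simp only [Real.ball_eq_Ioo]
      refine ⟨_, ⟨i, fun d => y d - r, fun d => y d + r, rfl⟩, ?_, ?_⟩
      · rw [← hpi]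
        exact ((isOpen_discrete {i}).prod Metric.isOpen_ball).mem_nhds
          ⟨rfl, Metric.mem_ball_self hr⟩
      · rw [← hpi]
        rintro ⟨j, y'⟩ ⟨hj, hy'⟩
        rw [mem_singleton_iff] at hj
        exact hu' ⟨hj ▸ hi, hball hy'⟩
    · rintro _ ⟨i, a, b, rfl⟩
      have hs := hSm _ ⟨i, a, b, rfl⟩
      rw [← ENNReal.tendsto_coe]
      have h1 : (mP ({i} ×ˢ Set.pi univ fun d => Ioo (a d) (b d)) :
          ENNReal) = ENNReal.ofReal (volume.real ((Set.pi univ fun d => Ioo (a d) (b d)) ∩ Icc 0 1) /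
            Fintype.card ι) := by
        rw [ProbabilityMeasure.ennreal_coeFn_eq_coeFn_toMeasure,
          show mP.toMeasure = m from rfl, ENNReal.ofReal_div_of_pos (by simp [Fintype.card_pos]), measureReal_def,
          ENNReal.ofReal_toReal]
        · rw [Measure.prod_prod, Measure.restrict_apply (MeasurableSet.univ_pi fun d =>
            measurableSet_Ioo)]
          simp [ENNReal.div_eq_inv_mul]
        · refine ((measure_mono inter_subset_right).trans_lt ?_).ne
          exact isCompact_Icc.measure_lt_top
      rw [h1]
      refine (ENNReal.tendsto_ofReal (hbase i a b)).congr' ?_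
      filter_upwards [eventually_ge_atTop 1] with T hT
      rw [ProbabilityMeasure.ennreal_coeFn_eq_coeFn_toMeasure, occupation_apply _ _ hT hs]
      congr 3
  have hp : Continuous fun p : ι × (Fin 2 → ℝ) => (p.1, torusMk p.2) :=
    continuous_fst.prodMk (continuous_torusMk.comp continuous_snd)
  have hmap := ProbabilityMeasure.tendsto_map_of_tendsto_of_continuous _ _ hlim hp
  have e1 : mP.map hp.measurable.aemeasurable =
      (⟨sheetUniform ι, inferInstance⟩ : ProbabilityMeasure (ι × UnitAddTorus (Fin 2))) := by
    apply Subtype.ext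
    simp only [ProbabilityMeasure.val_eq_to_measure, mP, m,
      sheetUniform]
    have h3 : (volume : Measure (Fin 2 → ℝ)).restrict (Icc 0 1) = volume.restrict (openCell 2) :=
      Measure.restrict_congr_set Measure.univ_pi_Ioo_ae_eq_Icc.symm
    have h4 := measurePreserving_torusMk 2
    rw [← h3] at h4
    exact ((MeasurePreserving.id _).prod h4).map_eq
  rw [e1] at hmap
  refine hmap.congr fun T => ?_
  rw [occupation_map _ _ hp.measurable]
  congr 1
  ext t : 1
  simp only [Function.comp_apply, torusMk_fractPart]

/-- Every ultrafilter limit projects to the limit on the base, which `hbase` makes uniform, so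
`limit_eq_uniform` leaves only one possible limit. -/
theorem tendsto_occupation_sheetCurve {I : ℝ → ι} (hI : Measurable I) (x₀ v : Fin 2 → ℝ)
    (z₀ w : ℝ) (hlin : LinearIndependent ℚ ![v 0, v 1, w]) (ε : Fin 2 → ℤ)
    (hε : ∀ d, (0 < v d ∧ ε d = 1) ∨ (v d < 0 ∧ ε d = -1))
    (hdyn : ∀ a : Fin 2 → ℤ, (∀ d, a d = 0 ∨ a d = ε d) → (∃ d, a d = 0) → ∃ σ : Equiv.Perm ι,
      ∀ (t τ : ℝ) (b : Fin 2 → ℤ), 0 ≤ t → 0 < τ →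
        x₀ + t • v - (fun d => (b d : ℝ)) ∈ openCell 2 →
        x₀ + (t + τ) • v - (fun d => (b d : ℝ)) - (fun d => (a d : ℝ)) ∈ openCell 2 →
        I (t + τ) = σ (I t))
    (hbase : ∀ (i : ι) (a b : Fin 2 → ℝ), Tendsto (fun T : ℝ =>
      volume.real {t ∈ Icc 0 T | I t = i ∧ fractPart (x₀ + t • v) ∈ Set.pi univ fun d =>
        Ioo (a d) (b d)} / T) atTop
      (𝓝 (volume.real ((Set.pi univ fun d => Ioo (a d) (b d)) ∩ Icc 0 1) / Fintype.card ι))) :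
    Tendsto (occupation (sheetCurve I x₀ v z₀ w) (measurable_sheetCurve hI x₀ v z₀ w)) atTop
      (𝓝 ⟨(sheetUniform ι).prod volume,
        haveI : IsProbabilityMeasure (volume : Measure UnitAddCircle) := ⟨by simp⟩
        inferInstance⟩) := by
  refine tendsto_of_forall_limit_eq fun U hU ν hν => ?_
  apply Subtype.ext
  refine limit_eq_uniform hI x₀ v z₀ w hlin ε hε hdyn hU hν ?_
  have hm : Measurable fun t : ℝ => (I t, torusMk (x₀ + t • v)) :=
    (measurable_sheetCurve hI x₀ v z₀ w).fst
  have h1 := (tendsto_occupation_base hI x₀ v hbase hm).mono_left hU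
  have h2 := ProbabilityMeasure.tendsto_map_of_tendsto_of_continuous _ _ hν
    (continuous_fst (X := ι × UnitAddTorus (Fin 2)) (Y := UnitAddCircle))
  have h3 : (fun T => (occupation (sheetCurve I x₀ v z₀ w)
      (measurable_sheetCurve hI x₀ v z₀ w) T).map
        (continuous_fst (X := ι × UnitAddTorus (Fin 2)) (Y := UnitAddCircle)).measurable.aemeasurable)
      = occupation (fun t : ℝ => (I t, torusMk (x₀ + t • v))) hm := by
    ext T : 1
    rw [occupation_map _ _ measurable_fst]
    rfl
  rw [h3] at h2
  have h4 := tendsto_nhds_unique h2 h1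
  have h5 := congrArg ProbabilityMeasure.toMeasure h4
  rw [ProbabilityMeasure.toMeasure_map] at h5
  exact h5

end Convergence

/-! ### From weak convergence to convex sets -/

theorem continuous_snoc_sheet {ι : Type*} [TopologicalSpace ι] : Continuous
    fun p : (ι × UnitAddTorus (Fin 2)) × UnitAddCircle =>
      (Fin.snoc p.1.2 p.2 : Fin 3 → UnitAddCircle) :=
  Continuous.finSnoc (A := fun _ : Fin 3 => UnitAddCircle) (continuous_snd.comp continuous_fst)
    continuous_snd

/-- The part over the sheet `i` that corresponds to the subset `A` of the unit cube. -/
def sheetPart {ι : Type*} (i : ι) (A : Set (Fin 3 → ℝ)) :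
    Set ((ι × UnitAddTorus (Fin 2)) × UnitAddCircle) :=
  {p | p.1.1 = i ∧ (Fin.snoc p.1.2 p.2 : Fin 3 → UnitAddCircle) ∈ torusMk '' A}

theorem isOpen_sheetPart {ι : Type*} [TopologicalSpace ι] [DiscreteTopology ι] (i : ι)
    {A : Set (Fin 3 → ℝ)} (hA : IsOpen A) :
    IsOpen (sheetPart i A) :=
  ((isOpen_discrete {i}).preimage (continuous_fst.comp continuous_fst)).inter
    ((isOpenMap_torusMk _ hA).preimage continuous_snoc_sheet)

theorem isClosed_sheetPart {ι : Type*} [TopologicalSpace ι] [DiscreteTopology ι] (i : ι)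
    {A : Set (Fin 3 → ℝ)} (hA : IsCompact A) :
    IsClosed (sheetPart i A) :=
  ((isClosed_discrete {i}).preimage (continuous_fst.comp continuous_fst)).inter
    ((hA.image continuous_torusMk).isClosed.preimage continuous_snoc_sheet)

section Squeeze

variable {ι : Type*} [Fintype ι] [TopologicalSpace ι] [DiscreteTopology ι]
  [MeasurableSpace ι] [BorelSpace ι] [Nonempty ι]

theorem measurePreserving_snoc (α : Type*) [MeasureSpace α] [SigmaFinite (volume : Measure α)]
    (n : ℕ) : MeasurePreserving (fun p : (Fin n → α) × α =>
      (Fin.snoc p.1 p.2 : Fin (n + 1) → α)) volume volume := by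
  have h1 := (volume_preserving_piFinSuccAbove (fun _ : Fin (n + 1) => α) (Fin.last n)).symm
  have h2 := h1.comp (Measure.measurePreserving_swap
    (μ := (volume : Measure (Fin n → α))) (ν := (volume : Measure α)))
  have e : (fun p : (Fin n → α) × α => (Fin.snoc p.1 p.2 : Fin (n + 1) → α)) =
      (MeasurableEquiv.piFinSuccAbove (fun _ : Fin (n + 1) => α) (Fin.last n)).symm ∘ Prod.swap := by
    ext p : 1
    exact (Fin.insertNth_last' _ _).symm
  rw [e]
  exact h2

theorem torusMk_snoc {n : ℕ} (y : Fin n → ℝ) (z : ℝ) :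
    (torusMk (Fin.snoc y z : Fin (n + 1) → ℝ) : Fin (n + 1) → UnitAddCircle) =
      (Fin.snoc (torusMk y) (z : UnitAddCircle) : Fin (n + 1) → UnitAddCircle) := by
  ext d
  refine Fin.lastCases ?_ (fun d => ?_) d <;> simp [torusMk]

theorem volume_torusMk_image {n : ℕ} {A : Set (Fin n → ℝ)} (hA : A ⊆ Icc 0 1)
    (hm : MeasurableSet (torusMk '' A)) : volume (torusMk '' A) = volume A :=
  measure_image_of_measurePreserving (measurePreserving_torusMk n)
    (fun _ hy _ hy' h => torusMk_injOn_openCell hy (hA hy') h) hm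
    (by
      have : A ≤ᵐ[volume] Icc (0 : Fin n → ℝ) 1 := Eventually.of_forall hA
      exact this.trans Measure.univ_pi_Ioo_ae_eq_Icc.symm.le)
    continuous_torusMk.measurable

theorem sheetUniform_prod_sheetPart (i : ι) {A : Set (Fin 3 → ℝ)} (hA : A ⊆ Icc 0 1)
    (hm : MeasurableSet (torusMk '' A)) :
    ((sheetUniform ι).prod volume) (sheetPart i A) = (Fintype.card ι : ENNReal)⁻¹ * volume A := by
  have hmp : MeasurePreserving (fun p : (ι × UnitAddTorus (Fin 2)) × UnitAddCircle =>
      (p.1.1, (Fin.snoc p.1.2 p.2 : Fin 3 → UnitAddCircle))) ((sheetUniform ι).prod volume)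
      (((Fintype.card ι : ENNReal)⁻¹ • Measure.count).prod volume) := by
    have hs : SigmaFinite ((Fintype.card ι : ENNReal)⁻¹ • (Measure.count : Measure ι)) := by
      have : IsFiniteMeasure ((Fintype.card ι : ENNReal)⁻¹ • (Measure.count : Measure ι)) :=
        ⟨by simp [ENNReal.mul_lt_top, Fintype.card_pos, ENNReal.inv_lt_top]⟩
      infer_instance
    have h1 : MeasurePreserving MeasurableEquiv.prodAssoc ((sheetUniform ι).prod volume)
        (((Fintype.card ι : ENNReal)⁻¹ • Measure.count).prod
          ((volume : Measure (UnitAddTorus (Fin 2))).prod (volume : Measure UnitAddCircle))) :=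
      ⟨MeasurableEquiv.prodAssoc.measurable, Measure.prodAssoc_prod⟩
    exact ((MeasurePreserving.id _).prod (measurePreserving_snoc UnitAddCircle 2)).comp h1
  have e : sheetPart i A = (fun p : (ι × UnitAddTorus (Fin 2)) × UnitAddCircle =>
      (p.1.1, (Fin.snoc p.1.2 p.2 : Fin 3 → UnitAddCircle))) ⁻¹' ({i} ×ˢ (torusMk '' A)) := rfl
  rw [e, hmp.measure_preimage ((measurableSet_singleton i).prod hm).nullMeasurableSet,
    Measure.prod_prod, volume_torusMk_image hA hm]
  simp

/-- If the occupation measures of a curve converge to the uniform distribution, then the proportion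
of time spent in a convex subset of a sheet converges to its normalized volume. -/
theorem tendsto_proportion_of_tendsto_occupation {Φ : ℝ → (ι × UnitAddTorus (Fin 2)) × UnitAddCircle}
    (hΦ : Measurable Φ) {m : ProbabilityMeasure ((ι × UnitAddTorus (Fin 2)) × UnitAddCircle)}
    (hm : m.toMeasure = (sheetUniform ι).prod volume)
    (hlim : Tendsto (occupation Φ hΦ) atTop (𝓝 m)) (i : ι) {S : Set (Fin 3 → ℝ)}
    (hS : S ⊆ Icc 0 1) (hconv : Convex ℝ S) (N : Set ℝ)
    (hN : ∀ᵐ t : ℝ, 0 ≤ t → (Φ t ∈ sheetPart i (interior S) → t ∈ N) ∧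
      (t ∈ N → Φ t ∈ sheetPart i (closure S))) :
    Tendsto (fun T : ℝ => volume.real {t ∈ Icc 0 T | t ∈ N} / T) atTop
      (𝓝 (volume.real S / Fintype.card ι)) := by
  have hcl : closure S ⊆ Icc 0 1 := closure_minimal hS isClosed_Icc
  have hcomp : IsCompact (closure S) := isCompact_Icc.of_isClosed_subset isClosed_closure hcl
  have hfr : volume (frontier S) = 0 := hconv.addHaar_frontier volume
  have hvint : volume (interior S) = volume S := by
    refine measure_congr ?_
    exact interior_ae_eq_of_null_frontier hfr
  have hvcl : volume (closure S) = volume S := measure_congr (closure_ae_eq_of_null_frontier hfr)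
  have ho := isOpen_sheetPart i (isOpen_interior (s := S))
  have hc := isClosed_sheetPart i hcomp
  have hmo : m.toMeasure (sheetPart i (interior S)) = (Fintype.card ι : ENNReal)⁻¹ * volume S := by
    rw [hm, sheetUniform_prod_sheetPart i (interior_subset.trans hS)
      (isOpenMap_torusMk _ isOpen_interior).measurableSet, hvint]
  have hmc : m.toMeasure (sheetPart i (closure S)) = (Fintype.card ι : ENNReal)⁻¹ * volume S := by
    rw [hm, sheetUniform_prod_sheetPart i hcl
      (hcomp.image continuous_torusMk).isClosed.measurableSet, hvcl]
  have hfin : ∀ (T : ℝ) (B : Set ℝ), volume {t ∈ Icc 0 T | t ∈ B} ≠ ⊤ := fun T B =>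
    ((measure_mono (sep_subset _ _)).trans_lt (isCompact_Icc (a := (0 : ℝ)) (b := T)).measure_lt_top).ne
  have hlim' : Tendsto (fun T : ℝ => ENNReal.ofReal (volume.real {t ∈ Icc 0 T | t ∈ N} / T)) atTop
      (𝓝 ((Fintype.card ι : ENNReal)⁻¹ * volume S)) := by
    -- Portmanteau from both sides: the open part over the interior of `S` bounds the lower limit,
    -- the closed part over its closure the upper one. Both have the volume of `S`, since the
    -- frontier of a convex set is null.
    refine tendsto_of_le_liminf_of_limsup_le ?_ ?_
    · rw [← hmo]
      refine (ProbabilityMeasure.le_liminf_measure_open_of_tendsto hlim ho).trans ?_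
      refine liminf_le_liminf ?_
      filter_upwards [eventually_ge_atTop 1] with T hT
      rw [occupation_apply Φ hΦ hT ho.measurableSet]
      refine ENNReal.ofReal_le_ofReal ?_
      refine div_le_div_of_nonneg_right (ENNReal.toReal_mono (hfin T N) (measure_mono_ae ?_))
        (by linarith)
      filter_upwards [hN] with t ht h
      exact ⟨h.1, (ht h.1.1).1 h.2⟩
    · rw [← hmc]
      refine le_trans ?_ (ProbabilityMeasure.limsup_measure_closed_le_of_tendsto hlim hc)
      refine limsup_le_limsup ?_
      filter_upwards [eventually_ge_atTop 1] with T hT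
      rw [occupation_apply Φ hΦ hT hc.measurableSet]
      refine ENNReal.ofReal_le_ofReal ?_
      refine div_le_div_of_nonneg_right (ENNReal.toReal_mono (hfin T (Φ ⁻¹' sheetPart i (closure S)))
        (measure_mono_ae ?_)) (by linarith)
      filter_upwards [hN] with t ht h
      exact ⟨h.1, (ht h.1.1).2 h.2⟩
  have hne : (Fintype.card ι : ENNReal)⁻¹ * volume S ≠ ⊤ := by
    rw [← hmo]; exact measure_ne_top _ _
  have h2 := (ENNReal.tendsto_toReal hne).comp hlim'
  have e : ((Fintype.card ι : ENNReal)⁻¹ * volume S).toReal = volume.real S / Fintype.card ι := by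
    rw [ENNReal.toReal_mul, ENNReal.toReal_inv, measureReal_def]
    simp [div_eq_inv_mul]
  rw [e] at h2
  refine h2.congr' ?_
  filter_upwards [eventually_gt_atTop 0] with T hT
  exact ENNReal.toReal_ofReal (div_nonneg measureReal_nonneg hT.le)

end Squeeze

/-! ### Local-to-global principles on the time axis -/

/-- A function on an interval that is locally constant on both sides of every point is constant. -/
theorem eq_of_locally_constant {α : Type*} (D : ℝ → α) {a b : ℝ} (hab : a ≤ b)
    (fwd : ∀ t ∈ Ico a b, ∃ ε : ℝ, 0 < ε ∧ ∀ h ∈ Icc (0 : ℝ) ε, D (t + h) = D t)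
    (bwd : ∀ t ∈ Ioc a b, ∃ ε : ℝ, 0 < ε ∧ ∀ h ∈ Icc (0 : ℝ) ε, D (t - h) = D t) :
    D b = D a := by
  have hclosed : IsClosed ({t | D t = D a} ∩ Icc a b) := by
    rw [← isOpen_compl_iff, Metric.isOpen_iff]
    intro t ht
    by_cases htab : t ∈ Icc a b
    · have hta : D t ≠ D a := fun h => ht ⟨h, htab⟩
      have h1 : ∃ ε : ℝ, 0 < ε ∧ ∀ s ∈ Icc a b, t ≤ s → s < t + ε → D s = D t := by
        rcases htab.2.eq_or_lt with h | h
        · exact ⟨1, one_pos, fun s hs hts _ => by rw [le_antisymm (hs.2.trans h.ge) hts]⟩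
        · obtain ⟨ε, hε, H⟩ := fwd t ⟨htab.1, h⟩
          refine ⟨ε, hε, fun s _ hts hs => ?_⟩
          have := H (s - t) ⟨by linarith, by linarith⟩
          rwa [add_sub_cancel] at this
      have h2 : ∃ ε : ℝ, 0 < ε ∧ ∀ s ∈ Icc a b, s ≤ t → t - ε < s → D s = D t := by
        rcases htab.1.eq_or_lt with h | h
        · exact ⟨1, one_pos, fun s hs hts _ => by rw [le_antisymm (hts.trans h.ge) hs.1, h]⟩
        · obtain ⟨ε, hε, H⟩ := bwd t ⟨h, htab.2⟩
          refine ⟨ε, hε, fun s _ hts hs => ?_⟩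
          have := H (t - s) ⟨by linarith, by linarith⟩
          rwa [sub_sub_cancel] at this
      obtain ⟨ε₁, hε₁, H₁⟩ := h1
      obtain ⟨ε₂, hε₂, H₂⟩ := h2
      refine ⟨min ε₁ ε₂, lt_min hε₁ hε₂, fun s hs hs' => hta ?_⟩
      rw [Metric.mem_ball, Real.dist_eq, abs_lt] at hs
      have m1 := min_le_left ε₁ ε₂
      have m2 := min_le_right ε₁ ε₂
      rw [← hs'.1]
      rcases le_total t s with h | h
      · exact (H₁ s hs'.2 h (by linarith [hs.2])).symm
      · exact (H₂ s hs'.2 h (by linarith [hs.1])).symm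
    · obtain ⟨ε, hε, H⟩ := Metric.isOpen_iff.1 (isClosed_Icc (a := a) (b := b)).isOpen_compl t htab
      exact ⟨ε, hε, fun s hs hs' => H hs hs'.2⟩
  -- Continuous induction: the set is closed, and `fwd` extends it to the right of each of its
  -- points before `b`.
  refine hclosed.mem_of_ge_of_forall_exists_gt rfl hab ?_
  rintro t ⟨ht, htab⟩
  obtain ⟨ε, hε, H⟩ := fwd t htab
  have h0 : 0 < min ε (b - t) := lt_min hε (sub_pos.2 htab.2)
  refine ⟨t + min ε (b - t), ?_, by linarith, by linarith [min_le_right ε (b - t)]⟩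
  change D _ = D a
  rw [H _ ⟨h0.le, min_le_left _ _⟩]
  exact ht

/-- A function that has locally the increments of a homomorphism has them globally. -/
theorem eq_add_of_local_increments {G : Type*} [AddCommGroup G] (Q φ : ℝ → G)
    (hφ : ∀ a b, φ (a + b) = φ a + φ b)
    (fwd : ∀ t : ℝ, 0 ≤ t → ∃ ε : ℝ, 0 < ε ∧ ∀ h ∈ Icc (0 : ℝ) ε, Q (t + h) = Q t + φ h)
    (bwd : ∀ t : ℝ, 0 < t → ∃ ε : ℝ, 0 < ε ∧ ∀ h ∈ Icc (0 : ℝ) ε, Q (t - h) = Q t - φ h)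
    {t : ℝ} (ht : 0 ≤ t) : Q t = Q 0 + φ t := by
  have h0 : φ 0 = 0 := by simpa using hφ 0 0
  have hsub : ∀ a b, φ (a - b) = φ a - φ b := by
    intro a b
    rw [eq_sub_iff_add_eq, ← hφ, sub_add_cancel]
  have := eq_of_locally_constant (fun t => Q t - φ t) ht (fun t ht => by
    obtain ⟨ε, hε, H⟩ := fwd t ht.1
    refine ⟨ε, hε, fun h hh => ?_⟩
    rw [H h hh, hφ]
    abel) (fun t ht => by
    obtain ⟨ε, hε, H⟩ := bwd t ht.1
    refine ⟨ε, hε, fun h hh => ?_⟩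
    rw [H h hh, hsub]
    abel)
  simp only [h0, sub_zero] at this
  rw [← this, sub_add_cancel]

theorem openCell_subset (n : ℕ) : openCell n ⊆ UnitCell n :=
  fun _ hy => ⟨fun d => (hy d trivial).1.le, fun d => (hy d trivial).2.le⟩

/-! ### Position and atomic square along a geodesic of the surface -/

namespace PolysquareSurface

variable {ι : Type*} (P : PolysquareSurface ι)

/-- The identification of the edges orthogonal to a coordinate axis. -/
def edgePerm : Fin 2 → Equiv.Perm ι := ![P.right, P.up]

open Classical in
/-- The atomic square that contains a given point in its interior, if there is one. -/
noncomputable def sheet : P.Point → Option ι :=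
  Quot.lift (fun c => if c.2.1 ∈ openCell 2 then some c.1 else none) (by
    have key : ∀ (p : UnitCell 2) (d : Fin 2), p.1 d = 0 ∨ p.1 d = 1 → p.1 ∉ openCell 2 := by
      intro p d hd hp
      have := hp d trivial
      rcases hd with h | h <;> rw [h] at this <;> simp at this
    intro a b h
    cases h with
    | right i p q hp hq h =>
      simp only [key p 0 (Or.inr hp), key q 0 (Or.inl hq), if_false]
    | up i p q hp hq h =>
      simp only [key p 1 (Or.inr hp), key q 1 (Or.inl hq), if_false])

open Classical in
/-- For a point in the interior of an edge orthogonal to the axis `d`, the atomic square for which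
this is the right (or top) edge. -/
noncomputable def edgeSheet (d : Fin 2) : P.Point → Option ι :=
  Quot.lift (fun c => if c.2.1 (d + 1) ∈ Ioo (0 : ℝ) 1 then
      (if c.2.1 d = 1 then some c.1 else
        if c.2.1 d = 0 then some ((P.edgePerm d).symm c.1) else none) else none) (by
    -- A gluing across axis `d` gives the same first square from both sides. A gluing across the
    -- other axis, which is `d + 1` in `Fin 2`, puts that coordinate at 0 or 1, and both sides give
    -- `none`.
    intro a b h
    cases h with
    | right i p q hp hq h =>
      fin_cases d
      · simp [hp, hq, h, edgePerm]
      · simp [hp, hq]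
    | up i p q hp hq h =>
      fin_cases d
      · simp [hp, hq]
      · simp [hp, hq, h, edgePerm])

/-- The position of a point in its atomic square, as a point of the torus. -/
def torusProj : P.Point → UnitAddTorus (Fin 2) :=
  Quot.lift (fun c => torusMk c.2.1) (by
    intro a b h
    cases h with
    | right i p q hp hq h =>
      ext d
      fin_cases d <;> simp [torusMk, hp, hq, h]
    | up i p q hp hq h =>
      ext d
      fin_cases d <;> simp [torusMk, hp, hq, h])

theorem torusProj_square (i : ι) (p : UnitCell 2) : P.torusProj (P.square i p) = torusMk p.1 := rfl

open Classical in
theorem sheet_square (i : ι) (p : UnitCell 2) :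
    P.sheet (P.square i p) = if p.1 ∈ openCell 2 then some i else none := rfl

open Classical in
theorem edgeSheet_square (d : Fin 2) (i : ι) (p : UnitCell 2) :
    P.edgeSheet d (P.square i p) = if p.1 (d + 1) ∈ Ioo (0 : ℝ) 1 then
      (if p.1 d = 1 then some i else
        if p.1 d = 0 then some ((P.edgePerm d).symm i) else none) else none := rfl

theorem sheet_square_eq_some {i j : ι} {p : UnitCell 2} :
    P.sheet (P.square i p) = some j ↔ p.1 ∈ openCell 2 ∧ i = j := by
  rw [sheet_square]
  split_ifs with h <;> simp [h]

theorem exists_square (x : P.Point) : ∃ (i : ι) (p : UnitCell 2), x = P.square i p := by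
  obtain ⟨⟨i, p⟩, rfl⟩ := Quot.exists_rep x
  exact ⟨i, p, rfl⟩

/-- Interior points are not glued to anything: `torusProj` recovers the position and `sheet` the
square. -/
theorem square_eq_square {i j : ι} {p q : UnitCell 2} (hp : p.1 ∈ openCell 2)
    (h : P.square i p = P.square j q) : i = j ∧ p = q := by
  refine ⟨?_, Subtype.ext (torusMk_injOn_openCell hp q.2 (congrArg P.torusProj h))⟩
  have h1 : P.sheet (P.square i p) = some i := P.sheet_square_eq_some.2 ⟨hp, rfl⟩
  rw [h] at h1
  exact (P.sheet_square_eq_some.1 h1).2.symm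

/-- A point over a point `y` of the open unit square has the position `y` in its atomic square. -/
theorem exists_eq_square {x : P.Point} {y : Fin 2 → ℝ} (hy : y ∈ openCell 2)
    (h : P.torusProj x = torusMk y) : ∃ i, x = P.square i ⟨y, openCell_subset 2 hy⟩ := by
  obtain ⟨i, p, rfl⟩ := P.exists_square x
  refine ⟨i, ?_⟩
  have := torusMk_injOn_openCell hy p.2 h.symm
  congr 1
  exact Subtype.ext this.symm

section Geodesic

variable {P} {v : Fin 2 → ℝ} {L : ℝ → P.Point}

/-- Modulo 1 the gluings disappear, so every straight segment has increment `h • v` on the torus,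
and these local increments add up. -/
theorem torusProj_geodesic (hL : IsHalfInfiniteGeodesic P.square P.singularSet v L) {x₀ : Fin 2 → ℝ} (hx₀ : torusMk x₀ = P.torusProj (L 0)) {t : ℝ}
    (ht : 0 ≤ t) : P.torusProj (L t) = torusMk (x₀ + t • v) := by
  rw [torusMk_add, hx₀]
  refine eq_add_of_local_increments (fun t => P.torusProj (L t)) (fun t => torusMk (t • v))
    (fun a b => by rw [add_smul, torusMk_add]) (fun t ht => ?_) (fun t ht => ?_) ht
  · obtain ⟨i, p, ε, hε, H⟩ := hL.forward t ht
    refine ⟨ε, hε, fun h hh => ?_⟩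
    obtain ⟨hp, e⟩ := H h hh
    obtain ⟨hp0, e0⟩ := H 0 ⟨le_rfl, hε.le⟩
    rw [add_zero] at e0
    simp only [e, e0, torusProj_square, zero_smul, add_zero, torusMk_add]
  · obtain ⟨i, p, ε, hε, H⟩ := hL.backward t ht
    refine ⟨ε, hε, fun h hh => ?_⟩
    obtain ⟨hp, e⟩ := H h hh
    obtain ⟨hp0, e0⟩ := H 0 ⟨le_rfl, hε.le⟩
    rw [sub_zero] at e0
    simp only [e, e0, torusProj_square, zero_smul, sub_zero, torusMk_sub]

theorem sheet_forward (hL : IsHalfInfiniteGeodesic P.square P.singularSet v L) {t : ℝ}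
    (ht : 0 ≤ t) {i : ι} (hi : P.sheet (L t) = some i) :
    ∃ ε : ℝ, 0 < ε ∧ ∀ h ∈ Icc (0 : ℝ) ε, P.sheet (L (t + h)) = some i := by
  obtain ⟨j, p, ε, hε, H⟩ := hL.forward t ht
  obtain ⟨hp0, e0⟩ := H 0 ⟨le_rfl, hε.le⟩
  rw [add_zero] at e0
  rw [e0, sheet_square_eq_some] at hi
  obtain ⟨hi, rfl⟩ := hi
  have hopen : IsOpen {h : ℝ | p + h • v ∈ openCell 2} :=
    (isOpen_openCell 2).preimage (by fun_prop)
  obtain ⟨δ, hδ, hball⟩ := Metric.isOpen_iff.1 hopen 0 hi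
  refine ⟨min ε (δ / 2), lt_min hε (by positivity), fun h hh => ?_⟩
  obtain ⟨hp, e⟩ := H h ⟨hh.1, hh.2.trans (min_le_left _ _)⟩
  rw [e, sheet_square_eq_some]
  refine ⟨hball ?_, rfl⟩
  rw [Metric.mem_ball, Real.dist_eq, sub_zero, abs_of_nonneg hh.1]
  linarith [hh.2, min_le_right ε (δ / 2)]

theorem sheet_backward (hL : IsHalfInfiniteGeodesic P.square P.singularSet v L) {t : ℝ}
    (ht : 0 < t) {i : ι} (hi : P.sheet (L t) = some i) :
    ∃ ε : ℝ, 0 < ε ∧ ∀ h ∈ Icc (0 : ℝ) ε, P.sheet (L (t - h)) = some i := by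
  obtain ⟨j, p, ε, hε, H⟩ := hL.backward t ht
  obtain ⟨hp0, e0⟩ := H 0 ⟨le_rfl, hε.le⟩
  rw [sub_zero] at e0
  rw [e0, sheet_square_eq_some] at hi
  obtain ⟨hi, rfl⟩ := hi
  have hopen : IsOpen {h : ℝ | p - h • v ∈ openCell 2} :=
    (isOpen_openCell 2).preimage (by fun_prop)
  obtain ⟨δ, hδ, hball⟩ := Metric.isOpen_iff.1 hopen 0 hi
  refine ⟨min ε (δ / 2), lt_min hε (by positivity), fun h hh => ?_⟩
  obtain ⟨hp, e⟩ := H h ⟨hh.1, hh.2.trans (min_le_left _ _)⟩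
  rw [e, sheet_square_eq_some]
  refine ⟨hball ?_, rfl⟩
  rw [Metric.mem_ball, Real.dist_eq, sub_zero, abs_of_nonneg hh.1]
  linarith [hh.2, min_le_right ε (δ / 2)]

/-- At a time when the position modulo `1` is in the open unit square, the geodesic is in the
interior of an atomic square. -/
theorem geodesic_eq_square (hL : IsHalfInfiniteGeodesic P.square P.singularSet v L)
    {x₀ : Fin 2 → ℝ} (hx₀ : torusMk x₀ = P.torusProj (L 0)) {t : ℝ} (ht : 0 ≤ t) {b : Fin 2 → ℤ}
    (hb : x₀ + t • v - (fun d => (b d : ℝ)) ∈ openCell 2) :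
    ∃ i, L t = P.square i ⟨_, openCell_subset 2 hb⟩ := by
  refine P.exists_eq_square hb ?_
  rw [torusProj_geodesic hL hx₀ ht, torusMk_eq_iff]
  exact ⟨b, by rw [sub_add_cancel]⟩

theorem exists_sheet_eq_some (hL : IsHalfInfiniteGeodesic P.square P.singularSet v L)
    {x₀ : Fin 2 → ℝ} (hx₀ : torusMk x₀ = P.torusProj (L 0)) {t : ℝ} (ht : 0 ≤ t) {b : Fin 2 → ℤ}
    (hb : x₀ + t • v - (fun d => (b d : ℝ)) ∈ openCell 2) : ∃ i, P.sheet (L t) = some i := by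
  obtain ⟨i, hi⟩ := geodesic_eq_square hL hx₀ ht hb
  exact ⟨i, by rw [hi, sheet_square_eq_some]; exact ⟨hb, rfl⟩⟩

/-- The geodesic stays in the same atomic square as long as it does not meet an edge. -/
theorem sheet_eq_of_mem_cell (hL : IsHalfInfiniteGeodesic P.square P.singularSet v L)
    {x₀ : Fin 2 → ℝ} (hx₀ : torusMk x₀ = P.torusProj (L 0)) {s t : ℝ} (hs : 0 ≤ s) (hst : s ≤ t)
    {b : Fin 2 → ℤ} (hb : ∀ u ∈ Icc s t, x₀ + u • v - (fun d => (b d : ℝ)) ∈ openCell 2) :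
    P.sheet (L t) = P.sheet (L s) := by
  refine eq_of_locally_constant (fun u => P.sheet (L u)) hst (fun u hu => ?_) fun u hu => ?_
  · obtain ⟨i, hi⟩ := exists_sheet_eq_some hL hx₀ (hs.trans hu.1) (hb u ⟨hu.1, hu.2.le⟩)
    obtain ⟨ε, hε, H⟩ := sheet_forward hL (hs.trans hu.1) hi
    exact ⟨ε, hε, fun h hh => (H h hh).trans hi.symm⟩
  · obtain ⟨i, hi⟩ := exists_sheet_eq_some hL hx₀ (hs.trans hu.1.le) (hb u ⟨hu.1.le, hu.2⟩)
    obtain ⟨ε, hε, H⟩ := sheet_backward hL (hs.trans_lt hu.1) hi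
    exact ⟨ε, hε, fun h hh => (H h hh).trans hi.symm⟩

/-- The positions of a point of the closed unit square that is, modulo `1`, in the interior of an
edge. -/
theorem coord_of_torusMk_eq {p y : Fin 2 → ℝ} (hp : p ∈ UnitCell 2) (h : torusMk p = torusMk y)
    {d : Fin 2} {k : ℤ} (hd : y d = k) (hd' : y (d + 1) ∈ Ioo (0 : ℝ) 1) :
    p (d + 1) = y (d + 1) ∧ (p d = 0 ∨ p d = 1) := by
  obtain ⟨a, ha⟩ := torusMk_eq_iff.1 h
  have e1 := congrFun ha (d + 1)
  have e0 := congrFun ha d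
  have p0 := hp.1 d
  have p1 := hp.2 d
  have q0 := hp.1 (d + 1)
  have q1 := hp.2 (d + 1)
  simp only [Pi.add_apply, Pi.zero_apply, Pi.one_apply, mem_Ioo] at e1 e0 p0 p1 q0 q1 hd'
  constructor
  · have h1 : (-1 : ℝ) < a (d + 1) := by linarith
    have h2 : (a (d + 1) : ℝ) < 1 := by linarith
    have h3 : -1 < a (d + 1) := by exact_mod_cast h1
    have h4 : a (d + 1) < 1 := by exact_mod_cast h2
    have : a (d + 1) = 0 := by omega
    rw [e1, this]; simp
  · rw [hd, ← Int.cast_add] at e0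
    rw [e0] at p0 p1 ⊢
    have h3 : 0 ≤ k + a d := by exact_mod_cast p0
    have h4 : k + a d ≤ 1 := by exact_mod_cast p1
    rcases (show k + a d = 0 ∨ k + a d = 1 by omega) with h | h <;> rw [h] <;> simp

/-- When the geodesic crosses the interior of an edge, it moves to the atomic square on the other
side of this edge. -/
theorem sheet_crossing (hL : IsHalfInfiniteGeodesic P.square P.singularSet v L)
    {x₀ : Fin 2 → ℝ} (hx₀ : torusMk x₀ = P.torusProj (L 0)) {u : ℝ} (hu : 0 < u) {b : Fin 2 → ℤ}
    {d : Fin 2} {k : ℤ} (hd : (x₀ + u • v - (fun d => (b d : ℝ))) d = k)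
    (hd' : (x₀ + u • v - (fun d => (b d : ℝ))) (d + 1) ∈ Ioo (0 : ℝ) 1) :
    ∃ (i j : ι) (ε : ℝ), 0 < ε ∧
      (∀ h ∈ Icc (0 : ℝ) ε, ∀ l, P.sheet (L (u - h)) = some l → l = i) ∧
      (∀ h ∈ Icc (0 : ℝ) ε, ∀ l, P.sheet (L (u + h)) = some l → l = j) ∧
      (0 < v d → j = P.edgePerm d i) ∧ (v d < 0 → i = P.edgePerm d j) := by
  obtain ⟨i, p, ε₁, hε₁, H₁⟩ := hL.backward u hu
  obtain ⟨j, q, ε₂, hε₂, H₂⟩ := hL.forward u hu.le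
  obtain ⟨hp0, ep0⟩ := H₁ 0 ⟨le_rfl, hε₁.le⟩
  obtain ⟨hq0, eq0⟩ := H₂ 0 ⟨le_rfl, hε₂.le⟩
  obtain ⟨hp1, -⟩ := H₁ ε₁ ⟨hε₁.le, le_rfl⟩
  obtain ⟨hq1, -⟩ := H₂ ε₂ ⟨hε₂.le, le_rfl⟩
  simp only [sub_zero, add_zero, zero_smul] at ep0 eq0 hp0 hq0
  set y := x₀ + u • v - (fun d => (b d : ℝ)) with hy
  have hproj : P.torusProj (L u) = torusMk y := by
    rw [torusProj_geodesic hL hx₀ hu.le, torusMk_eq_iff]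
    exact ⟨b, by rw [hy, sub_add_cancel]⟩
  have hpy : torusMk p = torusMk y := by rw [← hproj, ep0]; rfl
  have hqy : torusMk q = torusMk y := by rw [← hproj, eq0]; rfl
  obtain ⟨p', pd⟩ := coord_of_torusMk_eq hp0 hpy hd hd'
  obtain ⟨q', qd⟩ := coord_of_torusMk_eq hq0 hqy hd hd'
  -- The arriving and departing charts represent the same edge point, so `edgeSheet` compares their
  -- squares.
  have ep := congrArg (P.edgeSheet d) (ep0.symm.trans eq0)
  rw [edgeSheet_square, edgeSheet_square] at ep
  simp only [p', q', hd', if_true] at ep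
  have a0 := hp1.1 d
  have a1 := hp1.2 d
  have b0 := hq1.1 d
  have b1 := hq1.2 d
  simp only [Pi.add_apply, Pi.sub_apply, Pi.smul_apply, smul_eq_mul, Pi.zero_apply,
    Pi.one_apply] at a0 a1 b0 b1
  refine ⟨i, j, min ε₁ ε₂, lt_min hε₁ hε₂, fun h hh l hl => ?_, fun h hh l hl => ?_,
    fun hpos => ?_, fun hneg => ?_⟩
  · obtain ⟨hp, e⟩ := H₁ h ⟨hh.1, hh.2.trans (min_le_left _ _)⟩
    rw [e, sheet_square_eq_some] at hl
    exact hl.2.symm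
  · obtain ⟨hp, e⟩ := H₂ h ⟨hh.1, hh.2.trans (min_le_right _ _)⟩
    rw [e, sheet_square_eq_some] at hl
    exact hl.2.symm
  · have h1 := mul_pos hε₁ hpos
    have h2 := mul_pos hε₂ hpos
    -- Moving in the positive direction, the segment before the crossing stays in its square only if
    -- it ends at coordinate 1, and the one after it only if it starts at 0.
    have pd1 : p d = 1 := pd.resolve_left fun h => by linarith
    have qd0 : q d = 0 := qd.resolve_right fun h => by linarith
    simp only [pd1, qd0, if_true, zero_ne_one, if_false, Option.some.injEq] at ep
    rw [ep, Equiv.apply_symm_apply]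
  · have h1 := mul_neg_of_pos_of_neg hε₁ hneg
    have h2 := mul_neg_of_pos_of_neg hε₂ hneg
    have pd0 : p d = 0 := pd.resolve_right fun h => by linarith
    have qd1 : q d = 1 := qd.resolve_left fun h => by linarith
    simp only [pd0, qd1, if_true, zero_ne_one, if_false, Option.some.injEq] at ep
    rw [← ep, Equiv.apply_symm_apply]

end Geodesic

end PolysquareSurface

/-! ### Edge crossings and the itinerary -/

theorem affine_mem_Ioo {x c α β s t u : ℝ} (hs : x + s * c ∈ Ioo α β) (ht : x + t * c ∈ Ioo α β)
    (hu : u ∈ Icc s t) : x + u * c ∈ Ioo α β := by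
  rcases le_total 0 c with hc | hc
  · have h1 := mul_le_mul_of_nonneg_right hu.1 hc
    have h2 := mul_le_mul_of_nonneg_right hu.2 hc
    exact ⟨by linarith [hs.1], by linarith [ht.2]⟩
  · have h1 := mul_le_mul_of_nonpos_right hu.1 hc
    have h2 := mul_le_mul_of_nonpos_right hu.2 hc
    exact ⟨by linarith [ht.1], by linarith [hs.2]⟩

theorem mem_openCell_two {y : Fin 2 → ℝ} {d : Fin 2} (h0 : y d ∈ Ioo (0 : ℝ) 1)
    (h1 : y (d + 1) ∈ Ioo (0 : ℝ) 1) : y ∈ openCell 2 := by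
  intro e _
  fin_cases d <;> fin_cases e <;> simp_all

namespace PolysquareSurface

variable {ι : Type*} {P : PolysquareSurface ι} {v : Fin 2 → ℝ} {L : ℝ → P.Point}

/-- How a geodesic changes from an atomic square to a neighbouring one. -/
theorem sheet_eq_of_crossing (hL : IsHalfInfiniteGeodesic P.square P.singularSet v L)
    {x₀ : Fin 2 → ℝ} (hx₀ : torusMk x₀ = P.torusProj (L 0)) {s t u : ℝ} (hs : 0 ≤ s) (hsu : s < u)
    (hut : u < t) {b a : Fin 2 → ℤ} {d : Fin 2} {k : ℤ} (hd : x₀ d + u * v d - b d = k)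
    (h0 : ∀ r ∈ Icc s t, x₀ (d + 1) + r * v (d + 1) - b (d + 1) ∈ Ioo (0 : ℝ) 1)
    (ha : a (d + 1) = 0)
    (h1 : ∀ r ∈ Ico s u, x₀ d + r * v d - b d ∈ Ioo (0 : ℝ) 1)
    (h2 : ∀ r ∈ Ioc u t, x₀ d + r * v d - b d - a d ∈ Ioo (0 : ℝ) 1) :
    ∃ i j : ι, P.sheet (L s) = some i ∧ P.sheet (L t) = some j ∧
      (0 < v d → j = P.edgePerm d i) ∧ (v d < 0 → i = P.edgePerm d j) := by
  have hu : 0 < u := hs.trans_lt hsu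
  obtain ⟨i, j, ε, hε, hi, hj, hpos, hneg⟩ := sheet_crossing hL hx₀ hu (b := b) (d := d) (k := k)
    (by simpa using hd) (by simpa using h0 u ⟨hsu.le, hut.le⟩)
  have c1 : ∀ r ∈ Ico s u, x₀ + r • v - (fun d => (b d : ℝ)) ∈ openCell 2 := fun r hr =>
    mem_openCell_two (d := d) (by simpa using h1 r hr)
      (by simpa using h0 r ⟨hr.1, (hr.2.trans hut).le⟩)
  have c2 : ∀ r ∈ Ioc u t, x₀ + r • v - (fun d => ((b d + a d : ℤ) : ℝ)) ∈ openCell 2 := fun r hr =>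
    mem_openCell_two (d := d) (by
      have := h2 r hr
      simp only [Pi.add_apply, Pi.sub_apply, Pi.smul_apply, smul_eq_mul, Int.cast_add]
      rwa [← sub_sub])
      (by simpa [ha] using h0 r ⟨(hsu.trans hr.1).le, hr.2⟩)
  set h := min ε (min (u - s) (t - u)) with hh
  have hh0 : 0 < h := lt_min hε (lt_min (by linarith) (by linarith))
  have m1 : h ≤ ε := min_le_left _ _
  have m2 : h ≤ u - s := (min_le_right _ _).trans (min_le_left _ _)
  have m3 : h ≤ t - u := (min_le_right _ _).trans (min_le_right _ _)
  obtain ⟨i', hi'⟩ := exists_sheet_eq_some hL hx₀ hs (c1 s ⟨le_rfl, hsu⟩)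
  obtain ⟨j', hj'⟩ := exists_sheet_eq_some hL hx₀ (hu.trans hut).le (c2 t ⟨hut, le_rfl⟩)
  have e1 := sheet_eq_of_mem_cell hL hx₀ hs (show s ≤ u - h by linarith) (b := b)
    fun r hr => c1 r ⟨hr.1, by linarith [hr.2]⟩
  have e2 := sheet_eq_of_mem_cell hL hx₀ (show 0 ≤ u + h by linarith) (show u + h ≤ t by linarith)
    (b := fun d => b d + a d) fun r hr => c2 r ⟨by linarith [hr.1], hr.2⟩
  have f1 : i' = i := hi h ⟨hh0.le, m1⟩ i' (e1.trans hi')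
  have f2 : j' = j := hj h ⟨hh0.le, m1⟩ j' (e2.symm.trans hj')
  exact ⟨i, j, f1 ▸ hi', f2 ▸ hj', hpos, hneg⟩

/-- Between two times at which the geodesic is in the interior of the same or of neighbouring
squares of the square grid, it changes the atomic square by a fixed permutation. -/
theorem exists_perm_sheet (hL : IsHalfInfiniteGeodesic P.square P.singularSet v L)
    {x₀ : Fin 2 → ℝ} (hx₀ : torusMk x₀ = P.torusProj (L 0)) {ε : Fin 2 → ℤ}
    (hε : ∀ d, (0 < v d ∧ ε d = 1) ∨ (v d < 0 ∧ ε d = -1)) (a : Fin 2 → ℤ)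
    (ha : ∀ d, a d = 0 ∨ a d = ε d) (ha0 : ∃ d, a d = 0) :
    ∃ σ : Equiv.Perm ι, ∀ (t τ : ℝ) (b : Fin 2 → ℤ), 0 ≤ t → 0 < τ →
      x₀ + t • v - (fun d => (b d : ℝ)) ∈ openCell 2 →
      x₀ + (t + τ) • v - (fun d => (b d : ℝ)) - (fun d => (a d : ℝ)) ∈ openCell 2 →
      ∃ i, P.sheet (L t) = some i ∧ P.sheet (L (t + τ)) = some (σ i) := by
  -- The coordinate `d + 1` stays inside its unit interval, so only an edge orthogonal to axis `d`
  -- can be crossed, and in its interior.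
  obtain ⟨d, hd0⟩ : ∃ d : Fin 2, a (d + 1) = 0 := by
    obtain ⟨e, he⟩ := ha0
    refine ⟨e + 1, ?_⟩
    fin_cases e <;> simpa using he
  have hother : ∀ (t τ : ℝ) (b : Fin 2 → ℤ), 0 ≤ t → 0 < τ →
      x₀ + t • v - (fun d => (b d : ℝ)) ∈ openCell 2 →
      x₀ + (t + τ) • v - (fun d => (b d : ℝ)) - (fun d => (a d : ℝ)) ∈ openCell 2 →
      ∀ r ∈ Icc t (t + τ), x₀ (d + 1) + r * v (d + 1) - b (d + 1) ∈ Ioo (0 : ℝ) 1 := by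
    intro t τ b ht hτ h1 h2 r hr
    have e1 := h1 (d + 1) trivial
    have e2 := h2 (d + 1) trivial
    simp only [Pi.add_apply, Pi.sub_apply, Pi.smul_apply, smul_eq_mul, hd0, Int.cast_zero,
      sub_zero, add_sub_right_comm] at e1 e2 ⊢
    exact affine_mem_Ioo e1 e2 hr
  rcases ha d with hd | hd
  · refine ⟨1, fun t τ b ht hτ h1 h2 => ?_⟩
    obtain ⟨i, hi⟩ := exists_sheet_eq_some hL hx₀ ht h1
    refine ⟨i, hi, ?_⟩
    rw [Equiv.Perm.one_apply, ← hi]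
    refine sheet_eq_of_mem_cell hL hx₀ ht (by linarith) (b := b) fun r hr => ?_
    refine mem_openCell_two (d := d) ?_ (by simpa using hother t τ b ht hτ h1 h2 r hr)
    have e1 := h1 d trivial
    have e2 := h2 d trivial
    simp only [Pi.add_apply, Pi.sub_apply, Pi.smul_apply, smul_eq_mul, hd, Int.cast_zero,
      sub_zero, add_sub_right_comm] at e1 e2 ⊢
    exact affine_mem_Ioo e1 e2 hr
  · rcases hε d with ⟨hv, he⟩ | ⟨hv, he⟩
    · refine ⟨P.edgePerm d, fun t τ b ht hτ h1 h2 => ?_⟩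
      have e1 := h1 d trivial
      have e2 := h2 d trivial
      simp only [Pi.add_apply, Pi.sub_apply, Pi.smul_apply, smul_eq_mul, hd, he, Int.cast_one,
        mem_Ioo] at e1 e2
      -- The time at which coordinate `d`, relative to the cell `b`, reaches 1; for negative
      -- velocity it reaches 0 instead.
      set u := (1 + b d - x₀ d) / v d with hu
      have huv : u * v d = 1 + b d - x₀ d := div_mul_cancel₀ _ hv.ne'
      have htu : t < u := lt_of_mul_lt_mul_right (by linarith) hv.le
      have hut : u < t + τ := lt_of_mul_lt_mul_right (by linarith) hv.le
      obtain ⟨i, j, hi, hj, h, -⟩ := sheet_eq_of_crossing hL hx₀ ht htu hut (b := b) (a := a)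
        (d := d) (k := 1) (by rw [huv]; push_cast; ring) (hother t τ b ht hτ h1 h2) hd0
        (fun r hr => by
          have g1 := mul_le_mul_of_nonneg_right hr.1 hv.le
          have g2 := mul_lt_mul_of_pos_right hr.2 hv
          constructor <;> linarith)
        (fun r hr => by
          have g1 := mul_lt_mul_of_pos_right hr.1 hv
          have g2 := mul_le_mul_of_nonneg_right hr.2 hv.le
          rw [hd, he]
          push_cast
          constructor <;> linarith)
      exact ⟨i, hi, by rw [hj, h hv]⟩
    · refine ⟨(P.edgePerm d).symm, fun t τ b ht hτ h1 h2 => ?_⟩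
      have e1 := h1 d trivial
      have e2 := h2 d trivial
      simp only [Pi.add_apply, Pi.sub_apply, Pi.smul_apply, smul_eq_mul, hd, he, Int.cast_neg,
        Int.cast_one, mem_Ioo] at e1 e2
      set u := (b d - x₀ d) / v d with hu
      have huv : u * v d = b d - x₀ d := div_mul_cancel₀ _ hv.ne
      have htu : t < u := lt_of_mul_lt_mul_of_nonpos_right (by linarith) hv.le
      have hut : u < t + τ := lt_of_mul_lt_mul_of_nonpos_right (by linarith) hv.le
      obtain ⟨i, j, hi, hj, -, h⟩ := sheet_eq_of_crossing hL hx₀ ht htu hut (b := b) (a := a)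
        (d := d) (k := 0) (by rw [huv]; push_cast; ring) (hother t τ b ht hτ h1 h2) hd0
        (fun r hr => by
          have g1 := mul_le_mul_of_nonpos_right hr.1 hv.le
          have g2 := mul_lt_mul_of_neg_right hr.2 hv
          constructor <;> linarith)
        (fun r hr => by
          have g1 := mul_lt_mul_of_neg_right hr.1 hv
          have g2 := mul_le_mul_of_nonpos_right hr.2 hv.le
          rw [hd, he]
          push_cast
          constructor <;> linarith)
      refine ⟨i, hi, ?_⟩
      rw [hj, h hv, Equiv.symm_apply_apply]

/-- The atomic square of a geodesic at a time, with a default value where it is undefined. -/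
noncomputable def itinerary (L : ℝ → P.Point) (i₀ : ι) (t : ℝ) : ι :=
  open Classical in if 0 ≤ t then (P.sheet (L t)).getD i₀ else i₀

theorem itinerary_eq {i₀ i : ι} {t : ℝ} (ht : 0 ≤ t) (h : P.sheet (L t) = some i) :
    itinerary L i₀ t = i := by
  simp [itinerary, ht, h]

/-- The positive times spent in the interior of a given square form an open set; the fibre over the
default `i₀` is the complement of the others. -/
theorem measurable_itinerary [Countable ι] [MeasurableSpace ι] [MeasurableSingletonClass ι]
    (hL : IsHalfInfiniteGeodesic P.square P.singularSet v L) (i₀ : ι) :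
    Measurable (itinerary L i₀) := by
  have hV : ∀ i, MeasurableSet {t : ℝ | 0 ≤ t ∧ P.sheet (L t) = some i} := by
    intro i
    have hopen : IsOpen {t : ℝ | 0 < t ∧ P.sheet (L t) = some i} := by
      rw [Metric.isOpen_iff]
      rintro t ⟨ht, hi⟩
      obtain ⟨ε₁, hε₁, H₁⟩ := sheet_forward hL ht.le hi
      obtain ⟨ε₂, hε₂, H₂⟩ := sheet_backward hL ht hi
      refine ⟨min t (min ε₁ ε₂), lt_min ht (lt_min hε₁ hε₂), fun s hs => ?_⟩
      rw [Metric.mem_ball, Real.dist_eq, abs_lt] at hs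
      have m1 : min t (min ε₁ ε₂) ≤ t := min_le_left _ _
      have m2 : min t (min ε₁ ε₂) ≤ ε₁ := (min_le_right _ _).trans (min_le_left _ _)
      have m3 : min t (min ε₁ ε₂) ≤ ε₂ := (min_le_right _ _).trans (min_le_right _ _)
      refine ⟨by linarith [hs.1], ?_⟩
      rcases le_total t s with h | h
      · have := H₁ (s - t) ⟨by linarith, by linarith [hs.2]⟩
        rwa [add_sub_cancel] at this
      · have := H₂ (t - s) ⟨by linarith, by linarith [hs.1]⟩
        rwa [sub_sub_cancel] at this
    have e : {t : ℝ | 0 ≤ t ∧ P.sheet (L t) = some i} =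
        {t : ℝ | 0 < t ∧ P.sheet (L t) = some i} ∪ {t : ℝ | t = 0 ∧ P.sheet (L t) = some i} := by
      ext t
      simp only [mem_ofPred_eq, mem_union, ← or_and_right]
      rw [le_iff_lt_or_eq, eq_comm (a := (0 : ℝ))]
    rw [e]
    exact hopen.measurableSet.union
      (Set.Subsingleton.measurableSet fun s hs t ht => hs.1.trans ht.1.symm)
  refine measurable_to_countable' fun i => ?_
  by_cases hi : i = i₀
  · have e : itinerary L i₀ ⁻¹' {i} =
        (⋃ j : ι, ⋃ _ : j ≠ i₀, {t : ℝ | 0 ≤ t ∧ P.sheet (L t) = some j})ᶜ := by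
      ext t
      simp only [mem_preimage, mem_singleton_iff, mem_compl_iff, mem_iUnion, mem_ofPred_eq,
        exists_prop, not_exists, not_and, itinerary]
      by_cases ht : 0 ≤ t
      · cases h : P.sheet (L t) <;> simp [ht, hi]
        grind
      · simp [ht, hi]
    rw [e]
    exact (MeasurableSet.iUnion fun j => MeasurableSet.iUnion fun _ => hV j).compl
  · have e : itinerary L i₀ ⁻¹' {i} = {t : ℝ | 0 ≤ t ∧ P.sheet (L t) = some i} := by
      ext t
      simp only [mem_preimage, mem_singleton_iff, mem_ofPred_eq, itinerary]
      by_cases ht : 0 ≤ t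
      · cases h : P.sheet (L t) <;> simp [ht, Ne.symm hi]
      · simp [ht, Ne.symm hi]
    rw [e]
    exact hV i

end PolysquareSurface

/-! ### Uniform distribution passes from the surface to the manifold -/

theorem exists_torusMk_eq {n : ℕ} (x : UnitAddTorus (Fin n)) : ∃ y : Fin n → ℝ, torusMk y = x := by
  have h : ∀ d, ∃ y : ℝ, (y : UnitAddCircle) = x d := fun d => QuotientAddGroup.mk_surjective (x d)
  choose y hy using h
  exact ⟨y, funext hy⟩

theorem ae_affine_ne_intCast (x : ℝ) {c : ℝ} (hc : c ≠ 0) : ∀ᵐ t : ℝ, ∀ n : ℤ, x + t * c ≠ n := by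
  rw [ae_all_iff]
  intro n
  have : {t : ℝ | ¬ x + t * c ≠ n} ⊆ {(n - x) / c} := by
    intro t ht
    simp only [ne_eq, not_not, mem_ofPred_eq] at ht
    rw [mem_singleton_iff, eq_div_iff hc, ← ht]
    ring
  exact measure_mono_null this (by simp)

theorem fractPart_mem_openCell {n : ℕ} {y : Fin n → ℝ} (h : ∀ d, ∀ a : ℤ, y d ≠ a) :
    fractPart y ∈ openCell n := by
  intro d _
  refine ⟨lt_of_le_of_ne (Int.fract_nonneg _) fun h0 => h d ⌊y d⌋ ?_, Int.fract_lt_one _⟩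
  have := Int.self_sub_floor (y d)
  change 0 = Int.fract (y d) at h0
  linarith

theorem snoc_fractPart {n : ℕ} (y : Fin n → ℝ) (z : ℝ) :
    (Fin.snoc (fractPart y) (Int.fract z) : Fin (n + 1) → ℝ) =
      fractPart (Fin.snoc y z : Fin (n + 1) → ℝ) := by
  ext d
  refine Fin.lastCases ?_ (fun d => ?_) d <;> simp [fractPart]

namespace PolysquareSurface

variable {ι : Type*} {P : PolysquareSurface ι} {v : Fin 2 → ℝ} {w : ℝ}

theorem isGeodesic_fst {L : ℝ → P.Manifold}
    (hL : IsHalfInfiniteGeodesic P.cube P.manifoldSingularSet ![v 0, v 1, w] L) :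
    IsHalfInfiniteGeodesic P.square P.singularSet v fun t => (L t).1 := by
  have hadd : ∀ (p : Fin 3 → ℝ) (h : ℝ), Fin.init (p + h • ![v 0, v 1, w]) =
      (Fin.init p : Fin 2 → ℝ) + h • v := by
    intro p h; ext d; fin_cases d <;> simp [Fin.init]
  have hsub : ∀ (p : Fin 3 → ℝ) (h : ℝ), Fin.init (p - h • ![v 0, v 1, w]) =
      (Fin.init p : Fin 2 → ℝ) - h • v := by
    intro p h; ext d; fin_cases d <;> simp [Fin.init]
  refine ⟨fun t ht => hL.notMem_sing t ht, fun t ht => ?_, fun t ht => ?_⟩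
  · obtain ⟨i, p, ε, hε, H⟩ := hL.forward t ht
    refine ⟨i, Fin.init p, ε, hε, fun h hh => ?_⟩
    obtain ⟨hp, e⟩ := H h hh
    have hd : (dropLast ⟨_, hp⟩).1 = (Fin.init p : Fin 2 → ℝ) + h • v := hadd p h
    refine ⟨hd ▸ (dropLast ⟨_, hp⟩).2, ?_⟩
    rw [e]
    change P.square i (dropLast ⟨_, hp⟩) = _
    congr 1
    exact Subtype.ext hd
  · obtain ⟨i, p, ε, hε, H⟩ := hL.backward t ht
    refine ⟨i, Fin.init p, ε, hε, fun h hh => ?_⟩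
    obtain ⟨hp, e⟩ := H h hh
    have hd : (dropLast ⟨_, hp⟩).1 = (Fin.init p : Fin 2 → ℝ) - h • v := hsub p h
    refine ⟨hd ▸ (dropLast ⟨_, hp⟩).2, ?_⟩
    rw [e]
    change P.square i (dropLast ⟨_, hp⟩) = _
    congr 1
    exact Subtype.ext hd

theorem geodesic_snd {L : ℝ → P.Manifold}
    (hL : IsHalfInfiniteGeodesic P.cube P.manifoldSingularSet ![v 0, v 1, w] L) {z₀ : ℝ}
    (hz₀ : (z₀ : UnitAddCircle) = (L 0).2) {t : ℝ} (ht : 0 ≤ t) :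
    (L t).2 = ((z₀ + t * w : ℝ) : UnitAddCircle) := by
  rw [AddCircle.coe_add, hz₀]
  refine eq_add_of_local_increments (fun t => (L t).2) (fun t => ((t * w : ℝ) : UnitAddCircle))
    (fun a b => by rw [add_mul, AddCircle.coe_add]) (fun t ht => ?_) (fun t ht => ?_) ht
  · obtain ⟨i, p, ε, hε, H⟩ := hL.forward t ht
    refine ⟨ε, hε, fun h hh => ?_⟩
    obtain ⟨hp, e⟩ := H h hh
    obtain ⟨hp0, e0⟩ := H 0 ⟨le_rfl, hε.le⟩
    rw [add_zero] at e0
    rw [e, e0]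
    simp [cube]
  · obtain ⟨i, p, ε, hε, H⟩ := hL.backward t ht
    refine ⟨ε, hε, fun h hh => ?_⟩
    obtain ⟨hp, e⟩ := H h hh
    obtain ⟨hp0, e0⟩ := H 0 ⟨le_rfl, hε.le⟩
    rw [sub_zero] at e0
    rw [e, e0]
    simp [cube]

/-- A geodesic of the polycube manifold with a Kronecker direction is uniformly distributed if its
projection to the surface is. -/
theorem isUniformlyDistributed_of_fst [Fintype ι]
    (hlin : IsKroneckerDirection ![v 0, v 1, w]) {L : ℝ → P.Manifold}
    (hL : IsHalfInfiniteGeodesic P.cube P.manifoldSingularSet ![v 0, v 1, w] L)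
    (hud : IsUniformlyDistributed P.square fun t => (L t).1) : IsUniformlyDistributed P.cube L := by
  have := P.nonempty
  let _ : TopologicalSpace ι := ⊥
  have _ : DiscreteTopology ι := ⟨rfl⟩
  let _ : MeasurableSpace ι := borel ι
  have _ : BorelSpace ι := ⟨rfl⟩
  have hfst := isGeodesic_fst hL
  set K : ℝ → P.Point := fun t => (L t).1 with hK
  have hw : w ≠ 0 := hlin.ne_zero 2
  have hv : ∀ d, v d ≠ 0 := fun d => by
    fin_cases d
    · exact hlin.ne_zero 0
    · exact hlin.ne_zero 1
  obtain ⟨x₀, hx₀⟩ := exists_torusMk_eq (P.torusProj (K 0))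
  obtain ⟨z₀, hz₀⟩ : ∃ z₀ : ℝ, (z₀ : UnitAddCircle) = (L 0).2 :=
    QuotientAddGroup.mk_surjective (L 0).2
  let i₀ : ι := Classical.arbitrary ι
  have hI := measurable_itinerary hfst i₀
  set I := itinerary K i₀ with hIdef
  let ε : Fin 2 → ℤ := fun d => if 0 < v d then 1 else -1
  have hε : ∀ d, (0 < v d ∧ ε d = 1) ∨ (v d < 0 ∧ ε d = -1) := by
    intro d
    rcases lt_or_gt_of_ne (hv d) with h | h
    · exact Or.inr ⟨h, by simp [ε, h.le]⟩
    · exact Or.inl ⟨h, by simp [ε, h]⟩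
  -- Times on an edge are negligible, so the default value of the itinerary does not affect any
  -- proportion.
  have hgen : ∀ᵐ t : ℝ, fractPart (x₀ + t • v) ∈ openCell 2 := by
    filter_upwards [ae_affine_ne_intCast (x₀ 0) (hv 0), ae_affine_ne_intCast (x₀ 1) (hv 1)]
      with t h0 h1
    refine fractPart_mem_openCell fun d => ?_
    fin_cases d
    · exact h0
    · exact h1
  have hpos : ∀ t : ℝ, 0 ≤ t → ∀ (hc : fractPart (x₀ + t • v) ∈ openCell 2),
      K t = P.square (I t) ⟨_, openCell_subset 2 hc⟩ := by
    intro t ht hc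
    obtain ⟨i, hi⟩ := P.exists_eq_square hc
      ((torusProj_geodesic hfst hx₀ ht).trans (torusMk_fractPart _).symm)
    have : P.sheet (K t) = some i := by rw [hi, sheet_square_eq_some]; exact ⟨hc, rfl⟩
    rw [hIdef, itinerary_eq ht this, hi]
  have hdyn : ∀ a : Fin 2 → ℤ, (∀ d, a d = 0 ∨ a d = ε d) → (∃ d, a d = 0) →
      ∃ σ : Equiv.Perm ι, ∀ (t τ : ℝ) (b : Fin 2 → ℤ), 0 ≤ t → 0 < τ →
        x₀ + t • v - (fun d => (b d : ℝ)) ∈ openCell 2 →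
        x₀ + (t + τ) • v - (fun d => (b d : ℝ)) - (fun d => (a d : ℝ)) ∈ openCell 2 →
        I (t + τ) = σ (I t) := by
    intro a ha ha0
    obtain ⟨σ, hσ⟩ := exists_perm_sheet hfst hx₀ hε a ha ha0
    refine ⟨σ, fun t τ b ht hτ h1 h2 => ?_⟩
    obtain ⟨i, hi, hj⟩ := hσ t τ b ht hτ h1 h2
    rw [hIdef, itinerary_eq ht hi, itinerary_eq (by linarith) hj]
  have hbase : ∀ (i : ι) (a b : Fin 2 → ℝ), Tendsto (fun T : ℝ =>
      volume.real {t ∈ Icc 0 T | I t = i ∧ fractPart (x₀ + t • v) ∈ Set.pi univ fun d =>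
        Ioo (a d) (b d)} / T) atTop
      (𝓝 (volume.real ((Set.pi univ fun d => Ioo (a d) (b d)) ∩ Icc 0 1) / Fintype.card ι)) := by
    intro i a b
    refine (hud i _ (inter_subset_right (s := Set.pi univ fun d => Ioo (a d) (b d)))
      ((convex_pi fun _ _ => convex_Ioo _ _).inter (convex_Icc _ _))).congr fun T => ?_
    congr 1
    refine measureReal_congr ?_
    filter_upwards [hgen] with t hc
    refine propext ⟨fun h => ⟨h.1, ?_⟩, fun h => ⟨h.1, ?_⟩⟩
    · obtain ⟨q, hq, hqt⟩ := h.2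
      have e : P.square (I t) ⟨_, openCell_subset 2 hc⟩ = P.square i q :=
        (hpos t h.1.1 hc).symm.trans hqt.symm
      obtain ⟨e1, e2⟩ := P.square_eq_square hc e
      have e3 : fractPart (x₀ + t • v) = q.1 := congrArg Subtype.val e2
      exact ⟨e1, by rw [e3]; exact hq.1⟩
    · refine ⟨⟨_, openCell_subset 2 hc⟩, ⟨h.2.2, openCell_subset 2 hc⟩, ?_⟩
      rw [← h.2.1]
      exact (hpos t h.1.1 hc).symm
  intro i S hS hconv
  refine tendsto_proportion_of_tendsto_occupation (measurable_sheetCurve hI x₀ v z₀ w)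
    rfl (tendsto_occupation_sheetCurve hI x₀ v z₀ w hlin ε hε hdyn hbase) i hS hconv
    {t | L t ∈ P.cube i '' (Subtype.val ⁻¹' S)} ?_
  filter_upwards [hgen, ae_affine_ne_intCast z₀ hw] with t hc hz ht
  have hcl : closure S ⊆ Icc 0 1 := closure_minimal hS isClosed_Icc
  constructor
  · rintro ⟨hi, q, hq, hqt⟩
    have hc3 : fractPart (Fin.snoc (x₀ + t • v) (z₀ + t * w) : Fin 3 → ℝ) ∈ openCell 3 := by
      rw [← snoc_fractPart]
      intro d _
      refine Fin.lastCases ?_ (fun d => ?_) d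
      · simp only [Fin.snoc_last]
        refine ⟨lt_of_le_of_ne (Int.fract_nonneg _) fun h0 => hz ⌊z₀ + t * w⌋ ?_,
          Int.fract_lt_one _⟩
        have := Int.self_sub_floor (z₀ + t * w)
        linarith
      · simp only [Fin.snoc_castSucc]
        exact hc d trivial
    -- Both represent the same point of the torus in the closed cube, and the left one is interior.
    have e : fractPart (Fin.snoc (x₀ + t • v) (z₀ + t * w) : Fin 3 → ℝ) = q := by
      refine torusMk_injOn_openCell hc3 (hS (interior_subset hq)) ?_
      rw [torusMk_fractPart, hqt, torusMk_snoc]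
      rfl
    rw [← snoc_fractPart] at e
    refine ⟨⟨q, hS (interior_subset hq)⟩, (interior_subset hq : q ∈ S), ?_⟩
    refine Prod.ext ?_ ?_
    · change P.square i _ = K t
      have hi' : I t = i := hi
      rw [hpos t ht hc, hi']
      congr 1
      refine Subtype.ext ?_
      change Fin.init q = _
      rw [← e, Fin.init_snoc]
    · change ((q 2 : ℝ) : UnitAddCircle) = (L t).2
      rw [geodesic_snd hL hz₀ ht]
      have e2 : q 2 = Int.fract (z₀ + t * w) := by
        rw [← e]; exact Fin.snoc_last (α := fun _ : Fin 3 => ℝ) _ _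
      rw [e2, ← sub_eq_zero, ← AddCircle.coe_sub, AddCircle.coe_eq_zero_iff]
      refine ⟨-⌊z₀ + t * w⌋, ?_⟩
      rw [zsmul_one, Int.cast_neg, ← Int.self_sub_floor]
      ring
  · rintro ⟨q, hq, hqt⟩
    have e1 : P.square i (dropLast q) = K t := congrArg Prod.fst hqt
    have e2 : ((q.1 2 : ℝ) : UnitAddCircle) = ((z₀ + t * w : ℝ) : UnitAddCircle) :=
      (congrArg Prod.snd hqt).trans (geodesic_snd hL hz₀ ht)
    rw [hpos t ht hc] at e1
    obtain ⟨f1, f2⟩ := P.square_eq_square hc e1.symm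
    refine ⟨f1, q.1, subset_closure hq, ?_⟩
    have f3 : (Fin.init q.1 : Fin 2 → ℝ) = fractPart (x₀ + t • v) := congrArg Subtype.val f2.symm
    rw [← Fin.snoc_init_self q.1, torusMk_snoc, f3, torusMk_fractPart]
    have e3 : ((q.1 (Fin.last 2) : ℝ) : UnitAddCircle) = ((z₀ + t * w : ℝ) : UnitAddCircle) := e2
    rw [e3]
    rfl

end PolysquareSurface

/-! ### Lifting geodesics to the manifold -/

/-- Every Kronecker direction of the plane extends to one of the space. -/
theorem exists_isKroneckerDirection {v : Fin 2 → ℝ} (hv : IsKroneckerDirection v) :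
    ∃ w : ℝ, IsKroneckerDirection ![v 0, v 1, w] := by
  have hcount : (Submodule.span ℚ (range v) : Set ℝ).Countable := by
    have : (Submodule.span ℚ (range v) : Set ℝ) ⊆
        range fun c : Fin 2 → ℚ => ∑ i, c i • v i := fun x hx =>
      (Submodule.mem_span_range_iff_exists_fun ℚ).1 hx
    exact (countable_range _).mono this
  obtain ⟨w, hw⟩ : ∃ w, w ∉ Submodule.span ℚ (range v) := by
    by_contra! h
    have : (univ : Set ℝ).Countable := hcount.mono fun x _ => h x
    exact not_countable (countable_univ_iff.1 this)
  refine ⟨w, ?_⟩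
  have h := LinearIndependent.finSnoc hv hw
  have e : (Fin.snoc v w : Fin 3 → ℝ) = ![v 0, v 1, w] := by
    ext d; fin_cases d <;> rfl
  rw [← e]
  exact h

/-- A point of the circle that moves with constant velocity runs for some time in one copy of the
unit interval. -/
theorem exists_lift_unitInterval (z w : ℝ) : ∃ r ε : ℝ, 0 < ε ∧
    (∀ h ∈ Icc (0 : ℝ) ε, r + h * w ∈ Icc (0 : ℝ) 1) ∧
    ∀ h : ℝ, ((z + h * w : ℝ) : UnitAddCircle) = ((r + h * w : ℝ) : UnitAddCircle) := by
  rcases le_total 0 w with hw | hw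
  · have h1 : 0 < 1 - Int.fract z := by linarith [Int.fract_lt_one z]
    have hw1 : 0 < w + 1 := by linarith
    refine ⟨Int.fract z, (1 - Int.fract z) / (w + 1), by positivity, fun h hh => ?_, fun h => ?_⟩
    · have h2 : h * (w + 1) ≤ 1 - Int.fract z := (le_div_iff₀ hw1).1 hh.2
      have h3 := mul_nonneg hh.1 hw
      constructor
      · linarith [Int.fract_nonneg z]
      · linarith [hh.1]
    · rw [← sub_eq_zero, ← AddCircle.coe_sub, AddCircle.coe_eq_zero_iff]
      refine ⟨⌊z⌋, ?_⟩
      rw [zsmul_one, ← Int.self_sub_floor]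
      ring
  · have h1 : 0 < 1 - Int.fract (-z) := by linarith [Int.fract_lt_one (-z)]
    have hw1 : 0 < 1 - w := by linarith
    -- For downward motion the representative is taken in (0, 1], so that an integral `z` starts at
    -- 1 with room below.
    refine ⟨1 - Int.fract (-z), (1 - Int.fract (-z)) / (1 - w), by positivity, fun h hh => ?_,
      fun h => ?_⟩
    · have h2 : h * (1 - w) ≤ 1 - Int.fract (-z) := (le_div_iff₀ hw1).1 hh.2
      have h3 := mul_nonpos_of_nonneg_of_nonpos hh.1 hw
      constructor
      · linarith [hh.1]
      · linarith [Int.fract_nonneg (-z)]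
    · rw [← sub_eq_zero, ← AddCircle.coe_sub, AddCircle.coe_eq_zero_iff]
      refine ⟨-⌊-z⌋ - 1, ?_⟩
      rw [zsmul_one, ← Int.self_sub_floor]
      push_cast
      ring

namespace PolysquareSurface

variable {ι : Type*} {P : PolysquareSurface ι} {v : Fin 2 → ℝ}

theorem snoc_mem_unitCell {n : ℕ} {p : Fin n → ℝ} {r : ℝ} (hp : p ∈ UnitCell n)
    (hr : r ∈ Icc (0 : ℝ) 1) : (Fin.snoc p r : Fin (n + 1) → ℝ) ∈ UnitCell (n + 1) := by
  constructor <;> intro d <;> refine Fin.lastCases ?_ (fun d => ?_) d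
  · rw [Fin.snoc_last]; exact hr.1
  · rw [Fin.snoc_castSucc]; exact hp.1 d
  · rw [Fin.snoc_last]; exact hr.2
  · rw [Fin.snoc_castSucc]; exact hp.2 d

theorem cube_snoc (i : ι) {p : Fin 2 → ℝ} {r : ℝ} (hp : p ∈ UnitCell 2) (q : UnitCell 3)
    (hq : q.1 = (Fin.snoc p r : Fin 3 → ℝ)) :
    P.cube i q = (P.square i ⟨p, hp⟩, (r : UnitAddCircle)) := by
  refine Prod.ext ?_ ?_
  · change P.square i (dropLast q) = P.square i ⟨p, hp⟩
    congr 1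
    refine Subtype.ext ?_
    change Fin.init q.1 = p
    rw [hq, Fin.init_snoc]
  · change ((q.1 2 : ℝ) : UnitAddCircle) = _
    rw [hq]
    congr 1

/-- A geodesic of the surface lifts to the polycube manifold. -/
theorem isGeodesic_lift {L : ℝ → P.Point}
    (hL : IsHalfInfiniteGeodesic P.square P.singularSet v L) (w : ℝ) :
    IsHalfInfiniteGeodesic P.cube P.manifoldSingularSet ![v 0, v 1, w]
      fun t => (L t, ((t * w : ℝ) : UnitAddCircle)) := by
  have hadd : ∀ (p : Fin 2 → ℝ) (r h : ℝ), (Fin.snoc p r : Fin 3 → ℝ) + h • ![v 0, v 1, w] =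
      (Fin.snoc (p + h • v) (r + h * w) : Fin 3 → ℝ) := by
    intro p r h; ext d; fin_cases d <;> rfl
  have hsub : ∀ (p : Fin 2 → ℝ) (r h : ℝ), (Fin.snoc p r : Fin 3 → ℝ) - h • ![v 0, v 1, w] =
      (Fin.snoc (p - h • v) (r - h * w) : Fin 3 → ℝ) := by
    intro p r h; ext d; fin_cases d <;> rfl
  refine ⟨fun t ht => hL.notMem_sing t ht, fun t ht => ?_, fun t ht => ?_⟩
  · obtain ⟨i, p, ε, hε, H⟩ := hL.forward t ht
    obtain ⟨r, δ, hδ, hr, hrz⟩ := exists_lift_unitInterval (t * w) w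
    refine ⟨i, Fin.snoc p r, min ε δ, lt_min hε hδ, fun h hh => ?_⟩
    obtain ⟨hp, e⟩ := H h ⟨hh.1, hh.2.trans (min_le_left _ _)⟩
    have hc := snoc_mem_unitCell hp (hr h ⟨hh.1, hh.2.trans (min_le_right _ _)⟩)
    refine ⟨by rw [hadd]; exact hc, ?_⟩
    rw [cube_snoc i hp _ (hadd p r h), e, ← hrz, add_mul]
  · obtain ⟨i, p, ε, hε, H⟩ := hL.backward t ht
    -- Backwards in time the circle coordinate moves with velocity `-w`.
    obtain ⟨r, δ, hδ, hr, hrz⟩ := exists_lift_unitInterval (t * w) (-w)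
    simp only [mul_neg, ← sub_eq_add_neg] at hr hrz
    refine ⟨i, Fin.snoc p r, min ε δ, lt_min hε hδ, fun h hh => ?_⟩
    obtain ⟨hp, e⟩ := H h ⟨hh.1, hh.2.trans (min_le_left _ _)⟩
    have hc := snoc_mem_unitCell hp (hr h ⟨hh.1, hh.2.trans (min_le_right _ _)⟩)
    refine ⟨by rw [hsub]; exact hc, ?_⟩
    rw [cube_snoc i hp _ (hsub p r h), e, ← hrz, sub_mul]

theorem volume_cylinder (S : Set (Fin 2 → ℝ)) :
    volume.real {q : Fin 3 → ℝ | Fin.init q ∈ S ∧ q (Fin.last 2) ∈ Icc (0 : ℝ) 1} =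
      volume.real S := by
  have h := volume_preserving_piFinSuccAbove (fun _ : Fin 3 => ℝ) (Fin.last 2)
  have e : {q : Fin 3 → ℝ | Fin.init q ∈ S ∧ q (Fin.last 2) ∈ Icc (0 : ℝ) 1} =
      MeasurableEquiv.piFinSuccAbove (fun _ : Fin 3 => ℝ) (Fin.last 2) ⁻¹' (Icc (0 : ℝ) 1 ×ˢ S) := by
    ext q
    have : (MeasurableEquiv.piFinSuccAbove (fun _ : Fin 3 => ℝ) (Fin.last 2) q).2 = Fin.init q := by
      ext d
      fin_cases d <;> rfl
    rw [mem_preimage, mem_prod, this, and_comm]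
    rfl
  rw [measureReal_def, e, h.measure_preimage_equiv]
  change ((volume : Measure ℝ).prod (volume : Measure (Fin 2 → ℝ)) _).toReal = _
  rw [Measure.prod_prod, Real.volume_Icc]
  simp [measureReal_def]

/-- A geodesic of the surface is uniformly distributed if its lift to the polycube manifold is. -/
theorem isUniformlyDistributed_of_lift [Fintype ι] {L : ℝ → P.Point} {w : ℝ}
    (hud : IsUniformlyDistributed P.cube fun t => (L t, ((t * w : ℝ) : UnitAddCircle))) :
    IsUniformlyDistributed P.square L := by
  intro i S hS hconv
  -- The full cylinder over `S` is convex, has volume equal to the area of `S`, and is visited by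
  -- the lift exactly when `L` visits `S`.
  let S' : Set (Fin 3 → ℝ) := {q | Fin.init q ∈ S ∧ q (Fin.last 2) ∈ Icc (0 : ℝ) 1}
  have hsub : S' ⊆ UnitCell 3 := fun q hq => by
    rw [← Fin.snoc_init_self q]
    exact snoc_mem_unitCell (hS hq.1) hq.2
  have hconv' : Convex ℝ S' := by
    intro x hx y hy a b ha hb hab
    exact ⟨hconv hx.1 hy.1 ha hb hab, convex_Icc (0 : ℝ) 1 hx.2 hy.2 ha hb hab⟩
  have h := hud i S' hsub hconv'
  rw [volume_cylinder] at h
  refine h.congr fun T => ?_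
  congr 3
  ext t
  refine and_congr_right fun _ => ⟨?_, ?_⟩
  · rintro ⟨q, hq, hqt⟩
    exact ⟨dropLast q, hq.1, congrArg Prod.fst hqt⟩
  · rintro ⟨p, hp, hpt⟩
    have hr : Int.fract (t * w) ∈ Icc (0 : ℝ) 1 := ⟨Int.fract_nonneg _, (Int.fract_lt_one _).le⟩
    refine ⟨⟨Fin.snoc p.1 (Int.fract (t * w)), snoc_mem_unitCell p.2 hr⟩, ⟨?_, ?_⟩, ?_⟩
    · rw [Fin.init_snoc]; exact hp
    · change (Fin.snoc p.1 (Int.fract (t * w)) : Fin 3 → ℝ) (Fin.last 2) ∈ _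
      rw [Fin.snoc_last]; exact hr
    · rw [cube_snoc i p.2 _ rfl]
      refine Prod.ext hpt ?_
      simp only
      rw [← sub_eq_zero, ← AddCircle.coe_sub, AddCircle.coe_eq_zero_iff]
      refine ⟨-⌊t * w⌋, ?_⟩
      rw [zsmul_one, Int.cast_neg, ← Int.self_sub_floor]
      ring

end PolysquareSurface

theorem theorem6 {ι : Type*} [Fintype ι] (P : PolysquareSurface ι)
    (v : Fin 2 → ℝ) (hv : IsKroneckerDirection v) :
    (∀ L : ℝ → P.Point,
        IsHalfInfiniteGeodesic P.square P.singularSet v L → IsUniformlyDistributed P.square L) ↔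
      (∀ w : ℝ, IsKroneckerDirection ![v 0, v 1, w] →
        ∀ L : ℝ → P.Manifold,
          IsHalfInfiniteGeodesic P.cube P.manifoldSingularSet ![v 0, v 1, w] L →
            IsUniformlyDistributed P.cube L) := by
  constructor
  · intro h w hw L hL
    exact PolysquareSurface.isUniformlyDistributed_of_fst hw hL
      (h _ (PolysquareSurface.isGeodesic_fst hL))
  · intro h L hL
    -- One admissible `w` suffices, and its existence keeps (ii) from being vacuous.
    obtain ⟨w, hw⟩ := exists_isKroneckerDirection hv
    exact PolysquareSurface.isUniformlyDistributed_of_lift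
      (h w hw _ (PolysquareSurface.isGeodesic_lift hL w))
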